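/- **Setting.** Agents $i\in\mathcal I=\{1,\dots,N\}$ have uncertain dynamics $$\dot x_i=A_i(\mu_i)x_i+B_i(\mu_i)u_i+P_i(\mu_i)w_i,\qquad y_i=C_i(\mu_i)x_i,\qquad \dot w_i=S_iw_i,$$ with $x_i\in\mathbb R^{n_i}$, $u_i\in\mathbb R^{m_i}$, $w_i\in\mathbb R^{q_i}$, $y_i\in\mathbb R^{p_i}$ and arbitrary initial values $x_i(0)$, $w_i(0)$. Here $A_i(\mu_i)=A_i+\Delta A_i$, $B_i(\mu_i)=B_i+\Delta B_i$, $P_i(\mu_i)=P_i+\Delta P_i$, $C_i(\mu_i)=C_i+\Delta C_i$, where $A_i,B_i,P_i,C_i$ are the nominal parts and $\mu_i=(\Delta A_i,\Delta B_i,\Delta P_i,\Delta C_i)$ is the uncertainty; write $\mu=(\mu_1,\dots,\mu_N)$. Agent $i$ has the cost $$J_i(y)=y_i^{T}R_{ii}y_i+Q_{ii}y_i+c_i+\sum_{j\ne i}\bigl(y_i^{T}R_{ij}y_j+y_j^{T}Q_{ij}y_j\bigr),$$ where $x^TR_{ii}x>0$ for all $x\neq0$, and $R_{ij}=0$, $Q_{ij}=0$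 for $j\neq i$ unless $j$ is a neighbor of $i$ in the communication digraph (an edge $j\to i$). Let $\bar R$ be the block matrix with diagonal blocks $R_{ii}+R_{ii}^{T}$ and off-diagonal blocks $R_{ij}$, and let $\bar Q=\mathrm{col}(Q_{11}^{T},\dots,Q_{NN}^{T})$. Put $e_i=\nabla_iJ_i(y)=(\partial J_i/\partial y_i)^T$ and $\widetilde S_i=\begin{bmatrix}S_i&0\\0&0\end{bmatrix}\in\mathbb R^{(q_i+1)\times(q_i+1)}$, and let $s_i$ be the degree of the minimal polynomial of $\widetilde S_i$. A matrix is called Hurwitz if all its complex eigenvalues have negative real part. **Controller.** Agent $i$ uses only its partial gradient $e_i$: $$\dot\eta_i=M_{i1}\eta_i+M_{i2}e_i,\qquad u_i=K_i\eta_i,\qquad \eta_i\in\mathbb R^{n_i+p_is_i},$$ $$M_{i1}=\begin{bmatrix}A_i+B_iK_{i1}-L_i(R_{ii}+R_{ii}^{T})C_i & B_iK_{i2}\\ 0&G_{i1}\end{bmatrix},\qquad M_{i2}=\begin{bmatrix}L_i\\G_{i2}\end{bmatrix},\qquad K_i=[K_{i1}\ \ K_{i2}],$$ where (a) $A_i-L_i(R_{ii}+R_{ii}^{T})C_i$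 is Hurwitz; (b) $(G_{i1},G_{i2})$, of sizes $p_is_i\times p_is_i$ and $p_is_i\times p_i$, incorporates a $p_i$-copy internal model of $\widetilde S_i$. In general, $(M_1,M_2)$ incorporates a $p$-copy internal model of a square matrix $S$ if $M_1=V\begin{bmatrix}T_1&T_2\\0&G_1\end{bmatrix}V^{-1}$ and $M_2=V\begin{bmatrix}T_3\\G_2\end{bmatrix}$ for some nonsingular $V$, some matrices $T_1,T_2,T_3$ (possibly with no rows), and $G_1=\mathrm{blockdiag}(\beta_1,\dots,\beta_p)$, $G_2=\mathrm{blockdiag}(\sigma_1,\dots,\sigma_p)$, with each $\sigma_l$ a column, each pair $(\beta_l,\sigma_l)$ controllable, and the characteristic polynomial of each $\beta_l$ equal to the minimal polynomial of $S$; (c) the gain $K_i$ is such that $\begin{bmatrix}A_i+B_iK_{i1}&B_iK_{i2}\\ G_{i2}(R_{ii}+R_{ii}^{T})C_i&G_{i1}\end{bmatrix}$ is Hurwitz. **Assumptions.** 1. $\bar R$ is positive definite, i.e. $x^T\bar Rx>0$ for all $x\ne0$. 2. No $S_i$ has an eigenvalue with negative real part. 3. For each $i$, the nominal pair $(A_i,B_i)$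 is stabilizable and $(A_i,C_i)$ is detectable. 4. For each $i$ and each $\lambda\in\mathrm{spec}(S_i)\cup\{0\}$, $\ \mathrm{rank}\begin{bmatrix}A_i-\lambda I&B_i\\C_i&0\end{bmatrix}=n_i+p_i$. 5. The communication graph is a digraph with no directed loop (it is acyclic). **Theorem.** Under these assumptions the game with costs $J_i$ has a unique Nash equilibrium $y^*$, and $\bar Ry^*+\bar Q=0$. For every $i$ there exist $L_i$ satisfying (a) and $(G_{i1},G_{i2})$ satisfying (b), and for every $(G_{i1},G_{i2})$ satisfying (b) there is a gain $K_i$ satisfying (c). For every choice of $L_i,G_{i1},G_{i2},K_i$ ($i\in\mathcal I$) satisfying (a)–(c) there is a neighborhood of $\mu=0$ such that, for all $\mu$ in it, (i) the closed loop is stable: the matrix $A_c(\mu)$ of the closed-loop dynamics of $\mathrm{col}(x_1,\dots,x_N,\eta_1,\dots,\eta_N)$ is Hurwitz; and (ii) for all initial values of $x_i,\eta_i,w_i$, $i\in\mathcal I$, the output $y(t)=\mathrm{col}(y_1(t),\dots,y_N(t))$ converges to $y^*$ as $t\to\infty$. -/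

import Mathlib

open Matrix Filter Topology

noncomputable section

namespace NashSeeking

/-! ### Linear systems notions -/

/-- The spectrum of a real square matrix: its complex eigenvalues. -/
def spec {α : Type*} [Fintype α] [DecidableEq α] (M : Matrix α α ℝ) : Set ℂ :=
  spectrum ℂ (M.map Complex.ofReal)

/-- All eigenvalues have negative real part. -/
def IsHurwitz {α : Type*} [Fintype α] [DecidableEq α] (M : Matrix α α ℝ) : Prop :=
  ∀ z ∈ spec M, z.re < 0

def IsStabilizable {n m : ℕ} (A : Matrix (Fin n) (Fin n) ℝ) (B : Matrix (Fin n) (Fin m) ℝ) :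
    Prop :=
  ∃ K : Matrix (Fin m) (Fin n) ℝ, IsHurwitz (A + B * K)

def IsDetectable {n p : ℕ} (A : Matrix (Fin n) (Fin n) ℝ) (C : Matrix (Fin p) (Fin n) ℝ) :
    Prop :=
  ∃ L : Matrix (Fin n) (Fin p) ℝ, IsHurwitz (A - L * C)

/-- Controllability of a single-input pair `(β, σ)`: the Kalman matrix
`[σ, β σ, …, β ^ (s - 1) σ]` has full rank. -/
def IsControllable {s : ℕ} (β : Matrix (Fin s) (Fin s) ℝ) (σ : Fin s → ℝ) : Prop :=
  (Matrix.of fun a (k : Fin s) => ((β ^ (k : ℕ)) *ᵥ σ) a).rank = s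

/-- Positive definiteness of a real matrix which need not be symmetric. -/
def IsPosDef {α : Type*} [Fintype α] (M : Matrix α α ℝ) : Prop :=
  ∀ x : α → ℝ, x ≠ 0 → 0 < x ⬝ᵥ (M *ᵥ x)

/-- The order of the minimal polynomial of a square matrix. -/
def minpolyOrder {α : Type*} [Fintype α] [DecidableEq α] (S : Matrix α α ℝ) : ℕ :=
  (minpoly ℝ S).natDegree

/-- The block diagonal matrix with the column vectors `σ 0, …, σ (p - 1)` on its diagonal. -/
def columnBlocks {p s : ℕ} (σ : Fin p → Fin s → ℝ) : Matrix (Fin s × Fin p) (Fin p) ℝ :=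
  Matrix.of fun a l => if a.2 = l then σ l a.1 else 0

/-- The pair `(M₁, M₂)` incorporates a `p`-copy internal model of `S`. The nonsingular matrix `V`
is given with its inverse `W`; its columns are indexed by the block decomposition. -/
def IncorporatesInternalModel {α γ : Type*} [Fintype α] [DecidableEq α] [Fintype γ]
    [DecidableEq γ] {p : ℕ} (S : Matrix γ γ ℝ) (M₁ : Matrix α α ℝ) (M₂ : Matrix α (Fin p) ℝ) :
    Prop :=
  ∃ (β : Fin p → Matrix (Fin (minpolyOrder S)) (Fin (minpolyOrder S)) ℝ)
    (σ : Fin p → Fin (minpolyOrder S) → ℝ),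
    (∀ l, IsControllable (β l) (σ l) ∧ (β l).charpoly = minpoly ℝ S) ∧
    ∃ (k : ℕ) (T₁ : Matrix (Fin k) (Fin k) ℝ)
      (T₂ : Matrix (Fin k) (Fin (minpolyOrder S) × Fin p) ℝ) (T₃ : Matrix (Fin k) (Fin p) ℝ)
      (V : Matrix α (Fin k ⊕ (Fin (minpolyOrder S) × Fin p)) ℝ)
      (W : Matrix (Fin k ⊕ (Fin (minpolyOrder S) × Fin p)) α ℝ),
      V * W = 1 ∧ W * V = 1 ∧
      M₁ = V * fromBlocks T₁ T₂ 0 (blockDiagonal β) * W ∧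
      M₂ = V * fromRows T₃ (columnBlocks σ)

/-! ### The network game -/

/-- The data of a network game of `N` agents: nominal dynamics
`ẋᵢ = Aᵢ xᵢ + Bᵢ uᵢ + Pᵢ wᵢ`, `yᵢ = Cᵢ xᵢ`, exosystems `ẇᵢ = Sᵢ wᵢ`, and the coefficients
`Rᵢⱼ`, `Qᵢᵢ` (here `Q i`), `qᵢ` (here `c i`), `Qᵢⱼ` (here `Qoff i j`, for `j ≠ i`)
of the quadratic costs. -/
structure NetworkGame (N : ℕ) where
  n : Fin N → ℕ
  m : Fin N → ℕ
  q : Fin N → ℕ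
  p : Fin N → ℕ
  A : ∀ i, Matrix (Fin (n i)) (Fin (n i)) ℝ
  B : ∀ i, Matrix (Fin (n i)) (Fin (m i)) ℝ
  P : ∀ i, Matrix (Fin (n i)) (Fin (q i)) ℝ
  C : ∀ i, Matrix (Fin (p i)) (Fin (n i)) ℝ
  S : ∀ i, Matrix (Fin (q i)) (Fin (q i)) ℝ
  R : ∀ i j, Matrix (Fin (p i)) (Fin (p j)) ℝ
  Q : ∀ i, Fin (p i) → ℝ
  c : Fin N → ℝ
  Qoff : ∀ _i j : Fin N, Matrix (Fin (p j)) (Fin (p j)) ℝ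

namespace NetworkGame

variable {N : ℕ} (g : NetworkGame N)

/-- Joint decision variables `y = col(y₁, …, y_N)`. -/
abbrev Outputs : Type := ∀ i, Fin (g.p i) → ℝ

/-- The cost `Jᵢ`. -/
def cost (i : Fin N) (y : g.Outputs) : ℝ :=
  y i ⬝ᵥ (g.R i i *ᵥ y i) + g.Q i ⬝ᵥ y i + g.c i +
    ∑ j ∈ Finset.univ.erase i, (y i ⬝ᵥ (g.R i j *ᵥ y j) + y j ⬝ᵥ (g.Qoff i j *ᵥ y j))

/-- Nash equilibria of the game. -/
def IsNash (y : g.Outputs) : Prop :=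
  ∀ i (z : Fin (g.p i) → ℝ), g.cost i y ≤ g.cost i (Function.update y i z)

/-- The partial gradient `∇ᵢ Jᵢ` of agent `i`'s cost in its own decision variable. -/
def partialGrad (i : Fin N) (y : g.Outputs) : Fin (g.p i) → ℝ := fun k =>
  deriv (fun t : ℝ => g.cost i (Function.update y i (Function.update (y i) k t))) (y i k)

/-- The matrix `R̄`, with blocks `Rᵢⱼ` off the diagonal and `Rᵢᵢ + Rᵢᵢᵀ` on it. -/
def Rbar : Matrix (Σ i, Fin (g.p i)) (Σ i, Fin (g.p i)) ℝ :=
  Matrix.of fun a b =>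
    if a.1 = b.1 then (g.R a.1 b.1 + (g.R b.1 a.1)ᵀ) a.2 b.2 else g.R a.1 b.1 a.2 b.2

/-- The vector `Q̄`. -/
def Qbar : (Σ i, Fin (g.p i)) → ℝ := fun a => g.Q a.1 a.2

/-- The stacked vector `col(y₁, …, y_N)`. -/
def stack (y : g.Outputs) : (Σ i, Fin (g.p i)) → ℝ := fun a => y a.1 a.2

/-- The game uses the digraph `G`, where an edge `j → i` means that `j` is a neighbor of `i`
(agent `i` receives `yⱼ`): the cost of `i` involves no outputs but those of `i`
and its neighbors. -/
def UsesGraph (G : Digraph (Fin N)) : Prop :=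
  ∀ i j, j ≠ i → ¬ G.Adj j i → g.R i j = 0 ∧ g.Qoff i j = 0

/-- The extended exosystem matrix `S̃ᵢ = diag(Sᵢ, 0)`. -/
def Stilde (i : Fin N) : Matrix (Fin (g.q i) ⊕ Fin 1) (Fin (g.q i) ⊕ Fin 1) ℝ :=
  fromBlocks (g.S i) 0 0 0

/-- The order `sᵢ` of the minimal polynomial of `S̃ᵢ`. -/
def s (i : Fin N) : ℕ := minpolyOrder (g.Stilde i)

/-- `(Rᵢᵢ + Rᵢᵢᵀ) Cᵢ`. -/
def RC (i : Fin N) : Matrix (Fin (g.p i)) (Fin (g.n i)) ℝ := (g.R i i + (g.R i i)ᵀ) * g.C i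

/-- Uncertainties `μ`: additive perturbations `(ΔAᵢ, ΔBᵢ, ΔPᵢ, ΔCᵢ)` of the nominal matrices. -/
abbrev Uncertainty : Type :=
  ∀ i, Matrix (Fin (g.n i)) (Fin (g.n i)) ℝ × Matrix (Fin (g.n i)) (Fin (g.m i)) ℝ ×
    Matrix (Fin (g.n i)) (Fin (g.q i)) ℝ × Matrix (Fin (g.p i)) (Fin (g.n i)) ℝ

variable {g}

def Aμ (μ : g.Uncertainty) (i : Fin N) : Matrix (Fin (g.n i)) (Fin (g.n i)) ℝ :=
  g.A i + (μ i).1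

def Bμ (μ : g.Uncertainty) (i : Fin N) : Matrix (Fin (g.n i)) (Fin (g.m i)) ℝ :=
  g.B i + (μ i).2.1

def Pμ (μ : g.Uncertainty) (i : Fin N) : Matrix (Fin (g.n i)) (Fin (g.q i)) ℝ :=
  g.P i + (μ i).2.2.1

def Cμ (μ : g.Uncertainty) (i : Fin N) : Matrix (Fin (g.p i)) (Fin (g.n i)) ℝ :=
  g.C i + (μ i).2.2.2

variable (g)

/-! ### The controller `η̇ᵢ = Mᵢ₁ ηᵢ + Mᵢ₂ eᵢ`, `uᵢ = Kᵢ ηᵢ` -/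

/-- The index set of the controller state `ηᵢ`, of dimension `nᵢ + pᵢ sᵢ`. -/
abbrev CtrlIdx (i : Fin N) : Type := Fin (g.n i) ⊕ Fin (g.p i * g.s i)

/-- The matrices `Lᵢ`, `Gᵢ₁`, `Gᵢ₂` and the gain `Kᵢ = [Kᵢ₁ Kᵢ₂]` of agent `i`. -/
structure LocalController (i : Fin N) where
  L : Matrix (Fin (g.n i)) (Fin (g.p i)) ℝ
  G₁ : Matrix (Fin (g.p i * g.s i)) (Fin (g.p i * g.s i)) ℝ
  G₂ : Matrix (Fin (g.p i * g.s i)) (Fin (g.p i)) ℝ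
  K : Matrix (Fin (g.m i)) (g.CtrlIdx i) ℝ

variable {g}

/-- `Mᵢ₁`. -/
def LocalController.M₁ {i : Fin N} (κ : g.LocalController i) :
    Matrix (g.CtrlIdx i) (g.CtrlIdx i) ℝ :=
  fromBlocks (g.A i + g.B i * κ.K.toCols₁ - κ.L * g.RC i) (g.B i * κ.K.toCols₂) 0 κ.G₁

/-- `Mᵢ₂`. -/
def LocalController.M₂ {i : Fin N} (κ : g.LocalController i) :
    Matrix (g.CtrlIdx i) (Fin (g.p i)) ℝ :=
  fromRows κ.L κ.G₂

variable (g)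

/-- The requirement on `Lᵢ`. -/
def IsObserverGain (i : Fin N) (L : Matrix (Fin (g.n i)) (Fin (g.p i)) ℝ) : Prop :=
  IsHurwitz (g.A i - L * g.RC i)

/-- The requirement on `(Gᵢ₁, Gᵢ₂)`. -/
def IsInternalModel (i : Fin N) (G₁ : Matrix (Fin (g.p i * g.s i)) (Fin (g.p i * g.s i)) ℝ)
    (G₂ : Matrix (Fin (g.p i * g.s i)) (Fin (g.p i)) ℝ) : Prop :=
  IncorporatesInternalModel (g.Stilde i) G₁ G₂

/-- The requirement on `Kᵢ = [Kᵢ₁ Kᵢ₂]`: the matrix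
`[Aᵢ + Bᵢ Kᵢ₁, Bᵢ Kᵢ₂; Gᵢ₂ (Rᵢᵢ + Rᵢᵢᵀ) Cᵢ, Gᵢ₁]` is Hurwitz. -/
def IsStabilizingGain (i : Fin N) (G₁ : Matrix (Fin (g.p i * g.s i)) (Fin (g.p i * g.s i)) ℝ)
    (G₂ : Matrix (Fin (g.p i * g.s i)) (Fin (g.p i)) ℝ)
    (K : Matrix (Fin (g.m i)) (g.CtrlIdx i) ℝ) : Prop :=
  IsHurwitz (fromBlocks (g.A i + g.B i * K.toCols₁) (g.B i * K.toCols₂) (G₂ * g.RC i) G₁)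

variable {g}

/-- The closed-loop matrix `A_c(μ)`, acting on `col(x₁, …, x_N, η₁, …, η_N)`. -/
def closedLoopMatrix (κ : ∀ i, g.LocalController i) (μ : g.Uncertainty) :
    Matrix ((Σ i, Fin (g.n i)) ⊕ (Σ i, g.CtrlIdx i)) ((Σ i, Fin (g.n i)) ⊕ (Σ i, g.CtrlIdx i)) ℝ :=
  fromBlocks (blockDiagonal' (Aμ μ))
    (blockDiagonal' (Bμ μ) * blockDiagonal' fun i => (κ i).K)
    ((blockDiagonal' fun i => (κ i).M₂) * g.Rbar * blockDiagonal' (Cμ μ))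
    (blockDiagonal' fun i => (κ i).M₁)

/-- The joint output `y(t)`, with `yᵢ(t) = Cᵢ(μᵢ) xᵢ(t)`. -/
def output (μ : g.Uncertainty) (x : ∀ i, ℝ → Fin (g.n i) → ℝ) (t : ℝ) : g.Outputs :=
  fun i => Cμ μ i *ᵥ x i t

/-- `(w, x, η)` is a solution on `[0, ∞)` of the exosystems and the closed loop; the controller of
agent `i` is driven by its partial gradient `eᵢ = ∇ᵢ Jᵢ(y)` alone. -/
structure IsTrajectory (κ : ∀ i, g.LocalController i) (μ : g.Uncertainty)
    (w : ∀ i, ℝ → Fin (g.q i) → ℝ) (x : ∀ i, ℝ → Fin (g.n i) → ℝ)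
    (η : ∀ i, ℝ → g.CtrlIdx i → ℝ) : Prop where
  exosystem : ∀ i, ∀ t ∈ Set.Ici (0 : ℝ),
    HasDerivWithinAt (w i) (g.S i *ᵥ w i t) (Set.Ici 0) t
  agent : ∀ i, ∀ t ∈ Set.Ici (0 : ℝ),
    HasDerivWithinAt (x i)
      (Aμ μ i *ᵥ x i t + Bμ μ i *ᵥ ((κ i).K *ᵥ η i t) + Pμ μ i *ᵥ w i t) (Set.Ici 0) t
  controller : ∀ i, ∀ t ∈ Set.Ici (0 : ℝ),
    HasDerivWithinAt (η i)
      ((κ i).M₁ *ᵥ η i t + (κ i).M₂ *ᵥ g.partialGrad i (output μ x t)) (Set.Ici 0) t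

/-- The controllers `κ` make the closed loop stable and drive the outputs to `yStar`,
for all uncertainties `μ` in a neighborhood of `0`, all disturbances generated by the exosystems
and all initial states. -/
def SolvesNashSeeking (κ : ∀ i, g.LocalController i) (yStar : g.Outputs) : Prop :=
  ∀ᶠ μ : g.Uncertainty in 𝓝 0,
    IsHurwitz (closedLoopMatrix κ μ) ∧
    ∀ w x η, IsTrajectory κ μ w x η → Tendsto (output μ x) atTop (𝓝 yStar)

end NetworkGame

/-- The digraph has no (directed) loop. -/
def NoLoop {N : ℕ} (G : Digraph (Fin N)) : Prop :=
  ∀ i, ¬ Relation.TransGen G.Adj i i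

end NashSeeking

end

/-! Each cost is quadratic with positive definite curvature in the agent's own variable, so a Nash
equilibrium is exactly a common zero of the partial gradients, that is, a solution of R̄y + Q̄ = 0.
Positive definiteness of R̄ makes this solution exist and be unique (`isNash_iff`,
`existsUnique_equilibrium`).

For the dynamics, acyclicity reduces the network to single agents. The gradient of an agent is an
affine function of its own output plus terms from its neighbors. Ordered along the graph, the closed
loop is block triangular, so it is Hurwitz once each agent's own loop is. At μ = 0 this is the
separation principle (`isHurwitz_agent_loop`). Being Hurwitz is an open condition, so it persists
near μ = 0.

Convergence is by induction along the graph. Once the neighbors' outputs converge, the gradient of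
the agent is its own affine term, with the limits of its neighbors as a constant, plus a vanishing
signal. The constant is one more exogenous mode at frequency 0, which is why S̃ᵢ carries an extra
zero block. A Sylvester equation gives the steady state, and the internal model forces the gradient
to vanish on it (`IncorporatesInternalModel.regulator`, `tendsto_agent_error`). This argument uses
only that the loop is Hurwitz, so it tolerates all small μ.

The gain Kᵢ comes from a preliminary state feedback, a Sylvester change of coordinates that
decouples the internal model from the plant, and Bass's stabilization of what remains. The rank
condition at the exosystem frequencies supplies the controllability needed there
(`exists_stabilizing_gain`). -/

open Matrix Filter Topology

noncomputable section

namespace NashSeeking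

/-! ### Spectra of real matrices -/

section Spectrum

variable {α β : Type*} [Fintype α] [DecidableEq α] [Fintype β] [DecidableEq β]

theorem mem_spec_iff_exists_mulVec {M : Matrix α α ℝ} {z : ℂ} :
    z ∈ spec M ↔ ∃ v : α → ℂ, v ≠ 0 ∧ M.map Complex.ofReal *ᵥ v = z • v := by
  rw [spec, spectrum.mem_iff, Matrix.isUnit_iff_isUnit_det, isUnit_iff_ne_zero, not_not,
    ← Matrix.exists_mulVec_eq_zero_iff]
  refine exists_congr fun v => and_congr_right fun _ => ?_
  rw [Matrix.sub_mulVec, Algebra.algebraMap_eq_smul_one, Matrix.smul_mulVec, Matrix.one_mulVec,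
    sub_eq_zero, eq_comm]

theorem mem_spec_iff_exists_vecMul {M : Matrix α α ℝ} {z : ℂ} :
    z ∈ spec M ↔ ∃ v : α → ℂ, v ≠ 0 ∧ v ᵥ* M.map Complex.ofReal = z • v := by
  rw [spec, spectrum.mem_iff, Matrix.isUnit_iff_isUnit_det, isUnit_iff_ne_zero, not_not,
    ← Matrix.exists_vecMul_eq_zero_iff]
  refine exists_congr fun v => and_congr_right fun _ => ?_
  rw [Matrix.vecMul_sub, Algebra.algebraMap_eq_smul_one, Matrix.vecMul_smul, Matrix.vecMul_one,
    sub_eq_zero, eq_comm]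

theorem spec_transpose (M : Matrix α α ℝ) : spec Mᵀ = spec M := by
  ext z
  rw [mem_spec_iff_exists_mulVec, mem_spec_iff_exists_vecMul]
  simp only [Matrix.transpose_map, Matrix.mulVec_transpose]

theorem map_mul_ofReal {l m n : Type*} [Fintype m] (M : Matrix l m ℝ) (N : Matrix m n ℝ) :
    (M * N).map Complex.ofReal = M.map Complex.ofReal * N.map Complex.ofReal :=
  Matrix.map_mul (f := Complex.ofRealHom)

theorem map_add_ofReal {l m : Type*} (M N : Matrix l m ℝ) :
    (M + N).map Complex.ofReal = M.map Complex.ofReal + N.map Complex.ofReal :=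
  Matrix.map_add _ Complex.ofReal_add _ _

theorem map_sub_ofReal {l m : Type*} (M N : Matrix l m ℝ) :
    (M - N).map Complex.ofReal = M.map Complex.ofReal - N.map Complex.ofReal :=
  Matrix.map_sub _ Complex.ofReal_sub _ _

theorem map_one_ofReal {α : Type*} [DecidableEq α] : (1 : Matrix α α ℝ).map Complex.ofReal = 1 :=
  Matrix.map_one _ Complex.ofReal_zero Complex.ofReal_one

theorem spec_neg (M : Matrix α α ℝ) : spec (-M) = -spec M := by
  rw [spec, spec, spectrum.neg_eq]
  congr 1
  ext; simp

theorem spec_add_smul_one (M : Matrix α α ℝ) (r : ℝ) {z : ℂ} :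
    z ∈ spec (M + r • 1) ↔ z - r ∈ spec M := by
  rw [mem_spec_iff_exists_mulVec, mem_spec_iff_exists_mulVec]
  refine exists_congr fun v => and_congr_right fun _ => ?_
  have : (M + r • 1).map Complex.ofReal = M.map Complex.ofReal + (r : ℂ) • 1 := by
    ext i j
    by_cases h : i = j <;> simp [h]
  rw [this, Matrix.add_mulVec, Matrix.smul_mulVec, Matrix.one_mulVec, sub_smul, eq_sub_iff_add_eq]

/-- A left eigenvector `v` of `M` is carried to `v ᵥ* V`, which is nonzero because `V` has a right
inverse. -/
theorem spec_conj (M : Matrix α α ℝ) (N : Matrix β β ℝ) (V : Matrix α β ℝ) (W : Matrix β α ℝ)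
    (hVW : V * W = 1) (h : M * V = V * N) : spec M ⊆ spec N := by
  intro z hz
  rw [mem_spec_iff_exists_vecMul] at hz ⊢
  obtain ⟨v, hv, h1⟩ := hz
  refine ⟨v ᵥ* V.map Complex.ofReal, fun h0 => hv ?_, ?_⟩
  · have : v ᵥ* (V * W).map Complex.ofReal = 0 := by
      rw [map_mul_ofReal, ← Matrix.vecMul_vecMul, h0, Matrix.zero_vecMul]
    rwa [hVW, map_one_ofReal, Matrix.vecMul_one] at this
  · rw [Matrix.vecMul_vecMul, ← map_mul_ofReal, ← h, map_mul_ofReal, ← Matrix.vecMul_vecMul, h1,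
      Matrix.smul_vecMul]

open scoped Matrix.Norms.Operator in
-- This is the source of robustness: the spectrum is upper hemicontinuous and the left half-plane is
-- open.
theorem isOpen_setOf_isHurwitz : IsOpen {M : Matrix α α ℝ | IsHurwitz M} := by
  have h1 : IsOpen {M : Matrix α α ℂ | spectrum ℂ M ⊆ {z | z.re < 0}} := by
    have := upperHemicontinuous_spectrum ℂ (Matrix α α ℂ)
    rw [upperHemicontinuous_iff_isOpen_preimage_Iic] at this
    exact this _ (isOpen_lt Complex.continuous_re continuous_const)
  have h2 : Continuous fun M : Matrix α α ℝ => M.map Complex.ofReal :=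
    continuous_id.matrix_map Complex.continuous_ofReal
  exact h1.preimage h2

end Spectrum

/-! ### Sylvester equations -/

section Sylvester

variable {α β : Type*} [Fintype α] [DecidableEq α] [Fintype β] [DecidableEq β]

theorem mul_aeval_of_mul_eq {X : Matrix α β ℂ} {A : Matrix α α ℂ} {S : Matrix β β ℂ}
    (h : A * X = X * S) (q : Polynomial ℂ) :
    Polynomial.aeval A q * X = X * Polynomial.aeval S q := by
  induction q using Polynomial.induction_on' with
  | add p q hp hq => simp only [map_add, Matrix.add_mul, Matrix.mul_add, hp, hq]
  | monomial k a =>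
    have hk : A ^ k * X = X * S ^ k := by
      induction k with
      | zero => simp
      | succ k ih => rw [pow_succ, pow_succ, Matrix.mul_assoc, h, ← Matrix.mul_assoc, ih,
          Matrix.mul_assoc]
    simp [Polynomial.aeval_monomial, Algebra.algebraMap_eq_smul_one, hk]

/-- Apply the characteristic polynomial of `A` to the intertwining relation: it kills `A`, while its
value at `S` is invertible because none of its roots is an eigenvalue of `S`. -/
theorem eq_zero_of_sylvester {X : Matrix α β ℂ} {A : Matrix α α ℂ} {S : Matrix β β ℂ}
    (h : A * X = X * S) (hd : Disjoint (spectrum ℂ A) (spectrum ℂ S)) : X = 0 := by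
  have h1 := mul_aeval_of_mul_eq h A.charpoly
  rw [Matrix.aeval_self_charpoly, Matrix.zero_mul] at h1
  have hu : IsUnit (Polynomial.aeval S A.charpoly) := by
    by_contra hu
    have hs := (IsAlgClosed.splits A.charpoly).eq_prod_roots_of_monic A.charpoly_monic
    rw [hs] at hu
    obtain ⟨k, hk, hk'⟩ := spectrum.exists_mem_of_not_isUnit_aeval_prod hu
    exact hd.le_bot ⟨Matrix.mem_spectrum_iff_isRoot_charpoly.2 hk', hk⟩
  rw [← Matrix.mul_one X, ← Matrix.mul_nonsing_inv _ ((Matrix.isUnit_iff_isUnit_det _).1 hu),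
    ← Matrix.mul_assoc, ← h1, Matrix.zero_mul]

theorem sylvester_injective {A : Matrix α α ℝ} {S : Matrix β β ℝ}
    (hd : Disjoint (spec A) (spec S)) {X : Matrix α β ℝ} (h : A * X = X * S) : X = 0 := by
  have := eq_zero_of_sylvester (X := X.map Complex.ofReal)
    (by rw [← map_mul_ofReal, h, map_mul_ofReal]) hd
  ext i j
  simpa using congrFun (congrFun this i) j

/-- An injective endomorphism of a finite-dimensional space is surjective. -/
theorem exists_sylvester {A : Matrix α α ℝ} {S : Matrix β β ℝ}
    (hd : Disjoint (spec A) (spec S)) (E : Matrix α β ℝ) :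
    ∃ X : Matrix α β ℝ, A * X - X * S = E := by
  let f : Matrix α β ℝ →ₗ[ℝ] Matrix α β ℝ :=
    { toFun := fun X => A * X - X * S
      map_add' := fun X Y => by simp only [Matrix.mul_add, Matrix.add_mul]; abel
      map_smul' := fun r X => by simp [smul_sub] }
  have hf : Function.Injective f := by
    rw [← LinearMap.ker_eq_bot, LinearMap.ker_eq_bot']
    exact fun X hX => sylvester_injective hd (sub_eq_zero.1 hX)
  exact LinearMap.injective_iff_surjective.1 hf E

end Sylvester

/-! ### Asymptotic stability -/

section Stability

/-- With `a = -z.re`, the function exp(-zt) y has derivative exp(-zt) d, eventually of norm at most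
(aε/2) exp(at). Integrating from `T` and multiplying back by exp(-at) leaves at most ε/2 plus a
decaying multiple of `‖g T‖`. -/
theorem tendsto_zero_of_scalar_ode {E : Type*} [NormedAddCommGroup E] [NormedSpace ℂ E] {z : ℂ}
    (hz : z.re < 0) {y d : ℝ → E}
    (hy : ∀ t ∈ Set.Ici (0 : ℝ), HasDerivWithinAt y (z • y t + d t) (Set.Ici 0) t)
    (hd : Tendsto d atTop (𝓝 0)) : Tendsto y atTop (𝓝 0) := by
  set a : ℝ := -z.re with ha
  have ha0 : 0 < a := by simpa [ha] using hz
  have hnorm : ∀ t : ℝ, ‖Complex.exp (-z * t)‖ = Real.exp (a * t) := fun t => by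
    rw [Complex.norm_exp]; simp [ha]
  rw [Metric.tendsto_atTop]
  intro ε hε
  obtain ⟨T₀, hT₀⟩ := Metric.tendsto_atTop.1 hd (a * ε / 2) (by positivity)
  set T := max T₀ 0
  have hT0 : 0 ≤ T := le_max_right _ _
  set g : ℝ → E := fun t => Complex.exp (-z * t) • y t with hg
  have hg' : ∀ t ∈ Set.Ici (0 : ℝ),
      HasDerivWithinAt g (Complex.exp (-z * t) • d t) (Set.Ici 0) t := by
    intro t ht
    have h1 : HasDerivAt (fun t : ℝ => Complex.exp (-z * t)) (Complex.exp (-z * t) * -z) t := by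
      have := ((hasDerivAt_id (t : ℂ)).const_mul (-z)).cexp.comp_ofReal
      simpa using this
    refine (h1.hasDerivWithinAt.smul (hy t ht)).congr_deriv ?_
    simp only [smul_add, smul_smul]
    module
  set B : ℝ → ℝ := fun t => ‖g T‖ + ε / 2 * (Real.exp (a * t) - Real.exp (a * T)) with hB
  have hbound : ∀ t, T ≤ t → ‖g t‖ ≤ B t := by
    intro t ht
    refine image_norm_le_of_norm_deriv_right_le_deriv_boundary (a := T) (b := t)
      (f' := fun t => Complex.exp (-z * t) • d t)
      (B' := fun t => ε / 2 * (Real.exp (a * t) * a)) ?_ ?_ ?_ ?_ ?_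
      (Set.right_mem_Icc.2 ht)
    · exact fun s hs => ((hg' s (hT0.trans hs.1)).continuousWithinAt).mono
        fun r hr => hT0.trans hr.1
    · exact fun s hs => (hg' s (hT0.trans hs.1)).mono
        (Set.Ici_subset_Ici.2 (hT0.trans hs.1))
    · simp [hB]
    · intro s
      have := (((hasDerivAt_id s).const_mul a).exp.sub_const (Real.exp (a * T))).const_mul (ε / 2)
      simpa [hB] using this.const_add ‖g T‖
    · intro s hs
      rw [norm_smul, hnorm]
      have := (hT₀ s ((le_max_left _ _).trans hs.1)).le
      rw [dist_zero_right] at this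
      calc _ ≤ Real.exp (a * s) * (a * ε / 2) := by gcongr
        _ = _ := by ring
  have hlim : Tendsto (fun t => ‖g T‖ * Real.exp (-(a * t))) atTop (𝓝 (‖g T‖ * 0)) :=
    (Real.tendsto_exp_neg_atTop_nhds_zero.comp (tendsto_id.const_mul_atTop ha0)).const_mul _
  rw [mul_zero] at hlim
  obtain ⟨T₁, hT₁⟩ := Metric.tendsto_atTop.1 hlim (ε / 2) (by positivity)
  refine ⟨max T T₁, fun t ht => ?_⟩
  have h1 := hbound t ((le_max_left _ _).trans ht)
  have h2 := hT₁ t ((le_max_right _ _).trans ht)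
  rw [dist_zero_right, Real.norm_of_nonneg (by positivity)] at h2
  rw [dist_zero_right]
  have h3 : ‖g t‖ = Real.exp (a * t) * ‖y t‖ := by rw [hg, norm_smul, hnorm]
  have h4 : ‖y t‖ = Real.exp (-(a * t)) * ‖g t‖ := by
    rw [h3, ← mul_assoc, ← Real.exp_add]; simp
  have h5 : Real.exp (-(a * t)) * Real.exp (a * t) = 1 := by rw [← Real.exp_add]; simp
  calc ‖y t‖ ≤ Real.exp (-(a * t)) * B t := by rw [h4]; gcongr
    _ = ‖g T‖ * Real.exp (-(a * t)) + ε / 2 * (Real.exp (-(a * t)) * Real.exp (a * t))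
        - ε / 2 * (Real.exp (-(a * t)) * Real.exp (a * T)) := by rw [hB]; ring
    _ ≤ ‖g T‖ * Real.exp (-(a * t)) + ε / 2 := by
        rw [h5]
        have : 0 ≤ ε / 2 * (Real.exp (-(a * t)) * Real.exp (a * T)) := by positivity
        linarith
    _ < ε := by linarith

variable {α : Type*} [Fintype α] [DecidableEq α]

theorem _root_.HasDerivWithinAt.matrix_mulVec {𝕜 : Type*} [NontriviallyNormedField 𝕜]
    [NormedAlgebra ℝ 𝕜] {m n : Type*} [Fintype m] [Fintype n] (M : Matrix m n 𝕜)
    {x : ℝ → n → 𝕜} {x' : n → 𝕜} {s : Set ℝ} {t : ℝ} (h : HasDerivWithinAt x x' s t) :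
    HasDerivWithinAt (fun t => M *ᵥ x t) (M *ᵥ x') s t := by
  rw [hasDerivWithinAt_pi] at h ⊢
  intro i
  exact HasDerivWithinAt.fun_sum fun j _ => (h j).const_mul (M i j)

theorem _root_.Filter.Tendsto.matrix_mulVec_zero {R : Type*} [Semiring R] [TopologicalSpace R]
    [IsTopologicalSemiring R] {m n : Type*} [Fintype n] (M : Matrix m n R)
    {x : ℝ → n → R} {l : Filter ℝ} (h : Tendsto x l (𝓝 0)) :
    Tendsto (fun t => M *ᵥ x t) l (𝓝 0) := by
  have : Continuous fun v : n → R => M *ᵥ v := by fun_prop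
  simpa [Function.comp_def] using (this.tendsto 0).comp h

/-- Linear factors are peeled off one at a time. If `Q` is the product of the remaining factors, `Q
*ᵥ x` solves a scalar equation with rate `z` whose forcing (F - z)Qx + Qd tends to zero.
Cayley–Hamilton later provides the starting point, so no Jordan form is needed. -/
theorem tendsto_zero_of_aeval_prod {F : Matrix α α ℂ} {x d : ℝ → α → ℂ}
    (hx : ∀ t ∈ Set.Ici (0 : ℝ), HasDerivWithinAt x (F *ᵥ x t + d t) (Set.Ici 0) t)
    (hd : Tendsto d atTop (𝓝 0)) (s : Multiset ℂ) (hs : ∀ z ∈ s, z.re < 0)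
    (h : Tendsto (fun t => Polynomial.aeval F
      (s.map fun z => Polynomial.X - Polynomial.C z).prod *ᵥ x t) atTop (𝓝 0)) :
    Tendsto x atTop (𝓝 0) := by
  induction s using Multiset.induction with
  | empty => simpa using h
  | cons z s ih =>
    refine ih (fun w hw => hs w (Multiset.mem_cons_of_mem hw)) ?_
    set q := (s.map fun z => Polynomial.X - Polynomial.C z).prod
    set Q := Polynomial.aeval F q
    have hcomm : Q * F = F * Q := by
      have := congrArg (Polynomial.aeval F) (mul_comm q Polynomial.X)
      simpa using this
    refine tendsto_zero_of_scalar_ode (hs z (Multiset.mem_cons_self z s))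
      (d := fun t => Polynomial.aeval F ((z ::ₘ s).map fun z => Polynomial.X - Polynomial.C z).prod
        *ᵥ x t + Q *ᵥ d t) (fun t ht => ?_) (by simpa using h.add (hd.matrix_mulVec_zero Q))
    refine ((hx t ht).matrix_mulVec Q).congr_deriv ?_
    simp only [Multiset.map_cons, Multiset.prod_cons, map_mul, map_sub, Polynomial.aeval_X,
      Polynomial.aeval_C, Algebra.algebraMap_eq_smul_one]
    change _ = _ + (((F - z • 1) * Q) *ᵥ x t + _)
    rw [Matrix.mulVec_add, Matrix.mulVec_mulVec, hcomm, Matrix.sub_mul, Matrix.sub_mulVec,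
      Matrix.smul_mul, Matrix.one_mul, Matrix.smul_mulVec]
    abel

/-- A solution of `ẋ = F x + d` with `F` Hurwitz and `d → 0` tends to `0`. -/
theorem IsHurwitz.tendsto_zero {F : Matrix α α ℝ} (hF : IsHurwitz F) {x d : ℝ → α → ℝ}
    (hx : ∀ t ∈ Set.Ici (0 : ℝ), HasDerivWithinAt x (F *ᵥ x t + d t) (Set.Ici 0) t)
    (hd : Tendsto d atTop (𝓝 0)) : Tendsto x atTop (𝓝 0) := by
  set Fc := F.map Complex.ofReal
  have hmap : ∀ v : α → ℝ, (fun i => ((F *ᵥ v) i : ℂ)) = Fc *ᵥ fun i => (v i : ℂ) := by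
    intro v
    ext i
    simp [Matrix.mulVec, dotProduct, Fc]
  have hx' : ∀ t ∈ Set.Ici (0 : ℝ), HasDerivWithinAt (fun t i => (x t i : ℂ))
      ((Fc *ᵥ fun i => (x t i : ℂ)) + fun i => (d t i : ℂ)) (Set.Ici 0) t := by
    intro t ht
    rw [← hmap, hasDerivWithinAt_pi]
    intro i
    have := (hasDerivWithinAt_pi.1 (hx t ht) i).ofReal_comp
    simpa using this
  have hd' : Tendsto (fun t i => (d t i : ℂ)) atTop (𝓝 0) := by
    rw [tendsto_pi_nhds] at hd ⊢
    intro i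
    simpa [Function.comp_def] using (Complex.continuous_ofReal.tendsto _).comp (hd i)
  have key := tendsto_zero_of_aeval_prod hx' hd' Fc.charpoly.roots
    (fun z hz => hF z (Matrix.mem_spectrum_iff_isRoot_charpoly.2
      (Polynomial.isRoot_of_mem_roots hz))) (by
      rw [← (IsAlgClosed.splits Fc.charpoly).eq_prod_roots_of_monic Fc.charpoly_monic,
        Matrix.aeval_self_charpoly]
      simp)
  rw [tendsto_pi_nhds] at key ⊢
  intro i
  have := (Complex.continuous_re.tendsto _).comp (key i)
  simpa [Function.comp_def] using this

end Stability

/-! ### Stabilization by Bass's method -/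

section Bass

variable {α m : Type*} [Fintype α] [DecidableEq α] [Fintype m]

open scoped Matrix.Norms.Operator in
theorem exists_linear_trajectory (F : Matrix α α ℝ) (x₀ : α → ℝ) :
    ∃ x : ℝ → α → ℝ, x 0 = x₀ ∧ ∀ t, HasDerivAt x (F *ᵥ x t) t := by
  refine ⟨fun t => NormedSpace.exp (t • F) *ᵥ x₀, by simp, fun t => ?_⟩
  have h := hasDerivAt_exp_smul_const' F t
  let f : Matrix α α ℝ →L[ℝ] α → ℝ := LinearMap.toContinuousLinearMap
    { toFun := fun M => M *ᵥ x₀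
      map_add' := fun M N => Matrix.add_mulVec M N x₀
      map_smul' := fun r M => by simp [Matrix.smul_mulVec] }
  have := f.hasFDerivAt.comp_hasDerivAt t h
  rw [Matrix.mulVec_mulVec]
  exact this

theorem dotProduct_mulVec_hasDerivAt {α : Type*} [Fintype α] (P F : Matrix α α ℝ) {x : ℝ → α → ℝ} {t : ℝ}
    (hx : HasDerivAt x (F *ᵥ x t) t) :
    HasDerivAt (fun t => x t ⬝ᵥ (P *ᵥ x t)) (x t ⬝ᵥ ((Fᵀ * P + P * F) *ᵥ x t)) t := by
  have h1 := hasDerivAt_pi.1 hx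
  have h2 := hasDerivAt_pi.1 ((hasDerivWithinAt_univ.1
    (hx.hasDerivWithinAt (s := Set.univ).matrix_mulVec P)))
  have h3 : HasDerivAt (fun t => x t ⬝ᵥ (P *ᵥ x t))
      (∑ i, ((F *ᵥ x t) i * (P *ᵥ x t) i + x t i * (P *ᵥ (F *ᵥ x t)) i)) t :=
    HasDerivAt.fun_sum fun i _ => (h1 i).mul (h2 i)
  refine h3.congr_deriv ?_
  rw [Finset.sum_add_distrib, Matrix.add_mulVec, dotProduct_add]
  congr 1
  · change (F *ᵥ x t) ⬝ᵥ (P *ᵥ x t) = _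
    rw [← Matrix.mulVec_mulVec, Matrix.dotProduct_mulVec (x t) Fᵀ, Matrix.vecMul_transpose]
  · rw [← Matrix.mulVec_mulVec]; rfl

/-- If `F` is Hurwitz and the Lyapunov derivative of `P` is nonpositive then `P` is nonnegative. -/
theorem IsHurwitz.lyapunov_nonneg {F P : Matrix α α ℝ} (hF : IsHurwitz F)
    (h : ∀ x : α → ℝ, x ⬝ᵥ ((Fᵀ * P + P * F) *ᵥ x) ≤ 0) (x : α → ℝ) : 0 ≤ x ⬝ᵥ (P *ᵥ x) := by
  obtain ⟨y, hy0, hy⟩ := exists_linear_trajectory F x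
  have hlim : Tendsto y atTop (𝓝 0) := hF.tendsto_zero (d := 0)
    (fun t _ => by simpa using (hy t).hasDerivWithinAt) tendsto_const_nhds
  -- The quadratic form does not increase along the trajectory and tends to 0, so its initial value
  -- is nonnegative.
  have hanti : Antitone fun t => y t ⬝ᵥ (P *ᵥ y t) := by
    refine antitone_of_deriv_nonpos (fun t => (dotProduct_mulVec_hasDerivAt P F (hy t)).differentiableAt)
      fun t => ?_
    rw [(dotProduct_mulVec_hasDerivAt P F (hy t)).deriv]
    exact h _
  have hc : Continuous fun v : α → ℝ => v ⬝ᵥ (P *ᵥ v) := by fun_prop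
  have := hanti.le_of_tendsto (by simpa [Function.comp_def] using (hc.tendsto 0).comp hlim) 0
  simpa [hy0] using this

theorem re_star_dotProduct_mulVec {α : Type*} [Fintype α] (P : Matrix α α ℝ) (v : α → ℂ) :
    (star v ⬝ᵥ (P.map Complex.ofReal *ᵥ v)).re =
      (fun i => (v i).re) ⬝ᵥ (P *ᵥ fun i => (v i).re) +
      (fun i => (v i).im) ⬝ᵥ (P *ᵥ fun i => (v i).im) := by
  simp only [dotProduct, Matrix.mulVec, Matrix.map_apply, Pi.star_apply, RCLike.star_def,
    Complex.re_sum, Complex.im_sum, Complex.mul_re, Complex.mul_im, Complex.conj_re, Complex.conj_im,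
    Complex.ofReal_re, Complex.ofReal_im, zero_mul, sub_zero, add_zero, neg_mul, sub_neg_eq_add,
    Finset.sum_add_distrib]

/-- Evaluating the equation on a left eigenvector gives 2 Re z · v*Pv = r · v*Pv, with v*Pv
positive. -/
theorem isHurwitz_of_lyapunov {M P : Matrix α α ℝ} (hP : P.PosDef) {r : ℝ} (hr : r < 0)
    (h : M * P + P * Mᵀ = r • P) : IsHurwitz M := by
  intro z hz
  obtain ⟨v, hv, hz⟩ := mem_spec_iff_exists_vecMul.1 hz
  set Mc := M.map Complex.ofReal
  set Pc := P.map Complex.ofReal with hPc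
  have hstar : star v ᵥ* Mc = star z • star v := by
    have := congrArg star hz
    rw [star_smul, Matrix.star_vecMul] at this
    rw [← this, ← Matrix.vecMul_transpose]
    congr 1
    ext i j; simp [Mc]
  have hT : Mcᵀ *ᵥ v = z • v := by rw [Matrix.mulVec_transpose, hz]
  have hc : Mc * Pc + Pc * Mcᵀ = (r : ℂ) • Pc := by
    have := congrArg (fun N => N.map Complex.ofReal) h
    simp only [map_add_ofReal, map_mul_ofReal] at this
    rw [show Mcᵀ = Mᵀ.map Complex.ofReal from rfl, this]
    ext i j; simp [Pc]
  have hq := congrArg (fun N => star v ⬝ᵥ (N *ᵥ v)) hc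
  simp only [Matrix.add_mulVec, dotProduct_add, ← Matrix.mulVec_mulVec, hT, Matrix.mulVec_smul,
    Matrix.smul_mulVec, dotProduct_smul, Matrix.dotProduct_mulVec (star v) Mc, hstar,
    smul_dotProduct, smul_eq_mul] at hq
  have hre := congrArg Complex.re hq
  set c := star v ⬝ᵥ (Pc *ᵥ v) with hcdef
  have hpos : 0 < c.re := by
    rw [hcdef, hPc, re_star_dotProduct_mulVec]
    have hps : ∀ x : α → ℝ, 0 ≤ x ⬝ᵥ (P *ᵥ x) := fun x => by
      simpa using hP.posSemidef.dotProduct_mulVec_nonneg x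
    by_cases ha : (fun i => (v i).re) = 0
    · have hb : (fun i => (v i).im) ≠ 0 := fun hb => hv (funext fun i =>
        Complex.ext (congrFun ha i) (congrFun hb i))
      have := hP.dotProduct_mulVec_pos hb
      simp only [star_trivial] at this
      linarith [hps fun i => (v i).re]
    · have := hP.dotProduct_mulVec_pos ha
      simp only [star_trivial] at this
      linarith [hps fun i => (v i).im]
  simp only [Complex.add_re, Complex.mul_re, RCLike.star_def, Complex.conj_re, Complex.conj_im,
    Complex.ofReal_re, Complex.ofReal_im] at hre
  have : (2 * z.re) * c.re = r * c.re := by linarith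
  have := mul_right_cancel₀ hpos.ne' this
  linarith

open scoped ComplexOrder in
-- For `w` in the kernel of `P`, evaluating the equation on `w` gives |Bᵀw|² = 0, and then P Dᵀw =
-- 0. So the kernel is `Dᵀ`-invariant and killed by `Bᵀ`; if nonzero, it contains an eigenvector
-- that the PBH condition excludes.
theorem isUnit_of_lyapunov_pbh {D P : Matrix α α ℝ} {B : Matrix α m ℝ} (hsymm : Pᵀ = P)
    (h : D * P + P * Dᵀ = 2 • (B * Bᵀ))
    (hpbh : ∀ (z : ℂ) (v : α → ℂ), v ᵥ* D.map Complex.ofReal = z • v →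
      v ᵥ* B.map Complex.ofReal = 0 → v = 0) : IsUnit P := by
  set Dc := D.map Complex.ofReal
  set Pc := P.map Complex.ofReal with hPc
  set Bc := B.map Complex.ofReal
  have hsymmc : Pcᵀ = Pc := by rw [hPc, ← Matrix.transpose_map, hsymm]
  have hc : Dc * Pc + Pc * Dcᵀ = (2 : ℂ) • (Bc * Bcᵀ) := by
    have := congrArg (fun N => N.map Complex.ofReal) h
    simp only [map_add_ofReal, map_mul_ofReal, two_smul] at this
    rw [two_smul]
    exact this
  have hker : ∀ w : α → ℂ, Pc *ᵥ w = 0 → Bcᵀ *ᵥ w = 0 ∧ Pc *ᵥ (Dcᵀ *ᵥ w) = 0 := by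
    intro w hw
    have hsw : star w ᵥ* Pc = 0 := by
      have := congrArg star hw
      rw [Matrix.star_mulVec, star_zero] at this
      rw [← this]
      congr 1
      nth_rw 1 [← hsymmc]
      ext i j; simp [Pc]
    have h1 := congrArg (fun N => star w ⬝ᵥ (N *ᵥ w)) hc
    simp only [Matrix.add_mulVec, ← Matrix.mulVec_mulVec, hw, Matrix.mulVec_zero, Matrix.dotProduct_mulVec (star w) Pc, hsw, zero_dotProduct,
      Matrix.smul_mulVec, dotProduct_smul, smul_eq_mul, zero_add] at h1
    have h2 : star w ⬝ᵥ (Bc *ᵥ (Bcᵀ *ᵥ w)) = star (Bcᵀ *ᵥ w) ⬝ᵥ (Bcᵀ *ᵥ w) := by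
      rw [Matrix.dotProduct_mulVec, Matrix.star_mulVec]
      congr 2
      ext i j; simp [Bc]
    rw [h2, eq_comm, mul_eq_zero, or_iff_right (by norm_num)] at h1
    have h3 := dotProduct_star_self_eq_zero.1 h1
    refine ⟨h3, ?_⟩
    have h4 := congrArg (fun N => N *ᵥ w) hc
    simpa only [Matrix.add_mulVec, ← Matrix.mulVec_mulVec, hw, Matrix.mulVec_zero, zero_add, h3,
      Matrix.smul_mulVec, smul_zero] using h4
  rw [Matrix.isUnit_iff_isUnit_det, isUnit_iff_ne_zero]
  intro hdet
  have hdetc : Pc.det = 0 := by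
    have : Pc.det = Complex.ofRealHom P.det := (RingHom.map_det Complex.ofRealHom P).symm
    rw [this, hdet, map_zero]
  obtain ⟨w, hw, hPw⟩ := Matrix.exists_mulVec_eq_zero_iff.2 hdetc
  let N : Submodule ℂ (α → ℂ) := LinearMap.ker Pc.mulVecLin
  have hmem : ∀ u, u ∈ N ↔ Pc *ᵥ u = 0 := fun u => by
    rw [LinearMap.mem_ker, Matrix.mulVecLin_apply]
  have : Nontrivial N := ⟨⟨⟨w, (hmem w).2 hPw⟩, 0, fun h => hw (congrArg Subtype.val h)⟩⟩
  let f : Module.End ℂ N := Dcᵀ.mulVecLin.restrict (p := N) (q := N) fun u hu =>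
    (hmem _).2 (hker u ((hmem u).1 hu)).2
  obtain ⟨z, hz⟩ := Module.End.exists_eigenvalue f
  obtain ⟨u, hu⟩ := hz.exists_hasEigenvector
  have h1 : Dcᵀ *ᵥ (u : α → ℂ) = z • (u : α → ℂ) := congrArg Subtype.val hu.apply_eq_smul
  have h2 := (hker u ((hmem _).1 u.2)).1
  rw [Matrix.mulVec_transpose] at h1 h2
  exact hu.2 (Subtype.ext (hpbh z u h1 h2))

/-- A pair `(G, B)` all of whose modes are controllable and not asymptotically stable
is stabilizable. -/
theorem exists_isHurwitz_of_pbh {G : Matrix α α ℝ} {B : Matrix α m ℝ}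
    (hG : ∀ z ∈ spec G, 0 ≤ z.re)
    (hpbh : ∀ (z : ℂ) (v : α → ℂ), v ᵥ* G.map Complex.ofReal = z • v →
      v ᵥ* B.map Complex.ofReal = 0 → v = 0) :
    ∃ K : Matrix m α ℝ, IsHurwitz (G + B * K) := by
  -- The shift moves the spectrum into the open right half-plane, so `D` and `-Dᵀ` have disjoint
  -- spectra and the Lyapunov equation for `D` is solvable.
  set D := G + (1 : ℝ) • (1 : Matrix α α ℝ) with hD
  have hspec : ∀ z ∈ spec D, 0 < z.re := by
    intro z hz
    have := hG _ ((spec_add_smul_one G 1).1 hz)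
    simp only [Complex.ofReal_one, Complex.sub_re, Complex.one_re] at this
    linarith
  have hHur : IsHurwitz (-Dᵀ) := by
    intro z hz
    rw [spec_neg, spec_transpose, Set.mem_neg] at hz
    have := hspec _ hz
    simpa using this
  have hdisj : Disjoint (spec D) (spec (-Dᵀ)) :=
    Set.disjoint_left.2 fun z h1 h2 => (hspec z h1).not_gt (hHur z h2)
  obtain ⟨P, hP⟩ := exists_sylvester hdisj (2 • (B * Bᵀ))
  rw [Matrix.mul_neg, sub_neg_eq_add] at hP
  have hsymm : Pᵀ = P := by
    rw [← sub_eq_zero]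
    refine sylvester_injective hdisj ?_
    have := congrArg Matrix.transpose hP
    simp only [Matrix.transpose_add, Matrix.transpose_mul, Matrix.transpose_transpose,
      Matrix.transpose_smul] at this
    rw [← hP] at this
    rw [Matrix.mul_sub, Matrix.mul_neg, Matrix.sub_mul, neg_sub, sub_eq_sub_iff_add_eq_add,
      add_comm, this, add_comm]
  have hunit : IsUnit P := by
    refine isUnit_of_lyapunov_pbh hsymm hP fun z v h1 h2 => hpbh (z - 1) v ?_ h2
    have : D.map Complex.ofReal = G.map Complex.ofReal + 1 := by
      rw [hD, one_smul, map_add_ofReal, map_one_ofReal]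
    rw [this, Matrix.vecMul_add, Matrix.vecMul_one] at h1
    rw [sub_smul, one_smul, ← h1, add_sub_cancel_right]
  have hnonneg : ∀ x : α → ℝ, 0 ≤ x ⬝ᵥ (P *ᵥ x) := by
    refine hHur.lyapunov_nonneg fun x => ?_
    have : (-Dᵀ)ᵀ * P + P * -Dᵀ = -(2 • (B * Bᵀ)) := by
      rw [← hP]; simp [add_comm]
    rw [this, Matrix.neg_mulVec, dotProduct_neg, Matrix.smul_mulVec, dotProduct_smul,
      ← Matrix.mulVec_mulVec, Matrix.dotProduct_mulVec, ← Matrix.mulVec_transpose]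
    have : 0 ≤ (Bᵀ *ᵥ x) ⬝ᵥ (Bᵀ *ᵥ x) := by simpa using dotProduct_star_self_nonneg (Bᵀ *ᵥ x)
    simpa using this
  have hpos : P.PosDef := by
    have hps : P.PosSemidef := Matrix.PosSemidef.of_dotProduct_mulVec_nonneg
      (by rw [Matrix.IsHermitian, Matrix.conjTranspose_eq_transpose_of_trivial, hsymm]) (by simpa using hnonneg)
    exact hps.posDef_iff_isUnit.2 hunit
  -- With this gain the feedback removes 2BBᵀ from GP + PGᵀ = 2BBᵀ - 2P, and -2P is left.
  refine ⟨-(Bᵀ * P⁻¹), isHurwitz_of_lyapunov hpos (r := -2) (by norm_num) ?_⟩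
  have hdet := (Matrix.isUnit_iff_isUnit_det P).1 hunit
  have h1 : (G + B * -(Bᵀ * P⁻¹)) * P = G * P - B * Bᵀ := by
    rw [Matrix.add_mul, Matrix.mul_neg, Matrix.neg_mul, Matrix.mul_assoc, Matrix.mul_assoc,
      Matrix.nonsing_inv_mul _ hdet, Matrix.mul_one, sub_eq_add_neg]
  have h2 : P * (G + B * -(Bᵀ * P⁻¹))ᵀ = P * Gᵀ - B * Bᵀ := by
    have := congrArg Matrix.transpose h1
    simpa [Matrix.transpose_mul, hsymm] using this
  rw [h1, h2]
  have h3 : G * P + P * Gᵀ + 2 • P = 2 • (B * Bᵀ) := by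
    rw [← hP, hD]
    simp only [one_smul, Matrix.transpose_add, Matrix.transpose_one, Matrix.add_mul, Matrix.mul_add,
      Matrix.one_mul, Matrix.mul_one]
    abel
  have h4 : G * P + P * Gᵀ = 2 • (B * Bᵀ) - 2 • P := eq_sub_of_add_eq h3
  calc G * P - B * Bᵀ + (P * Gᵀ - B * Bᵀ) = (G * P + P * Gᵀ) - 2 • (B * Bᵀ) := by abel
    _ = _ := by rw [h4]; module

end Bass

/-! ### Controllable pairs and internal models -/

section Controllable

theorem mulVec_surjective_of_rank_eq {K m n : Type*} [Field K] [Fintype m] [Fintype n]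
    {M : Matrix m n K} (h : M.rank = Fintype.card m) : Function.Surjective M.mulVec := by
  have : LinearMap.range M.mulVecLin = ⊤ := by
    refine Submodule.eq_top_of_finrank_eq ?_
    rw [Module.finrank_fintype_fun_eq_card, ← h, Matrix.rank]
  exact LinearMap.range_eq_top.1 this

theorem eq_zero_of_vecMul_eq_zero_of_rank_eq {K m n : Type*} [Field K] [Fintype m] [Fintype n]
    {M : Matrix m n K} (h : M.rank = Fintype.card m) {v : m → K} (hv : v ᵥ* M = 0) : v = 0 := by
  refine dotProduct_eq_zero v fun w => ?_
  obtain ⟨u, rfl⟩ := mulVec_surjective_of_rank_eq h w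
  rw [Matrix.dotProduct_mulVec, hv, zero_dotProduct]

theorem IsControllable.isUnit {s : ℕ} {β : Matrix (Fin s) (Fin s) ℝ} {σ : Fin s → ℝ}
    (h : IsControllable β σ) :
    IsUnit (Matrix.of fun a (k : Fin s) => ((β ^ (k : ℕ)) *ᵥ σ) a) := by
  rw [← Matrix.mulVec_surjective_iff_isUnit]
  exact mulVec_surjective_of_rank_eq (by rw [Fintype.card_fin]; exact h)

/-- The PBH test: a left eigenvector orthogonal to `σ` is orthogonal to every column of the Kalman
matrix. -/
theorem IsControllable.eq_zero_of_vecMul {s : ℕ} {β : Matrix (Fin s) (Fin s) ℝ} {σ : Fin s → ℝ}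
    (h : IsControllable β σ) {z : ℂ} {v : Fin s → ℂ} (hv : v ᵥ* β.map Complex.ofReal = z • v)
    (hσ : v ⬝ᵥ (fun a => (σ a : ℂ)) = 0) : v = 0 := by
  have hpow : ∀ k : ℕ, v ᵥ* (β ^ k).map Complex.ofReal = z ^ k • v := by
    intro k
    induction k with
    | zero => simp
    | succ k ih =>
      rw [pow_succ, map_mul_ofReal, ← Matrix.vecMul_vecMul, ih, Matrix.smul_vecMul, hv, smul_smul,
        pow_succ]
  set M := Matrix.of fun a (k : Fin s) => ((β ^ (k : ℕ)) *ᵥ σ) a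
  obtain ⟨M', hM'⟩ : ∃ M', M * M' = 1 := h.isUnit.exists_right_inv
  have h0 : v ᵥ* M.map Complex.ofReal = 0 := by
    ext k
    have : (v ᵥ* M.map Complex.ofReal) k =
        v ⬝ᵥ ((β ^ (k : ℕ)).map Complex.ofReal *ᵥ fun a => (σ a : ℂ)) := by
      simp [M, Matrix.vecMul, Matrix.mulVec, dotProduct]
    rw [this, Matrix.dotProduct_mulVec, hpow, smul_dotProduct, hσ, smul_zero, Pi.zero_apply]
  have := congrArg (fun u => u ᵥ* M'.map Complex.ofReal) h0
  simpa only [Matrix.vecMul_vecMul, ← map_mul_ofReal, hM', map_one_ofReal, Matrix.vecMul_one,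
    Matrix.zero_vecMul] using this

theorem IsControllable.exists_dual {s : ℕ} {β : Matrix (Fin s) (Fin s) ℝ} {σ : Fin s → ℝ}
    (h : IsControllable β σ) (d : Fin s → ℝ) :
    ∃ c : Fin s → ℝ, ∀ k : Fin s, c ⬝ᵥ ((β ^ (k : ℕ)) *ᵥ σ) = d k := by
  obtain ⟨M', hM'⟩ := h.isUnit.exists_left_inv
  refine ⟨d ᵥ* M', fun k => ?_⟩
  have := congrFun (congrArg (fun N => d ᵥ* N) hM') k
  rw [Matrix.vecMul_one, ← Matrix.vecMul_vecMul] at this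
  exact this

/-- No spectral assumption is needed: a functional `c` that sees only β^(s-1) σ detects `y` exactly
once, in degree `s`. Both `β` and `S` satisfy the monic `m`, so comparing `c` applied to `Z m(S)`
and to `m(β) Z` leaves `y = 0`. -/
theorem IsControllable.regulator {s : ℕ} {β : Matrix (Fin s) (Fin s) ℝ} {σ : Fin s → ℝ}
    (h : IsControllable β σ) (hs : 0 < s) {γ : Type*} [Fintype γ] [DecidableEq γ]
    {S : Matrix γ γ ℝ} {m : Polynomial ℝ} (hm : m.Monic) (hdeg : m.natDegree = s)
    (hβ : Polynomial.aeval β m = 0) (hS : Polynomial.aeval S m = 0)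
    {Z : Matrix (Fin s) γ ℝ} {y : γ → ℝ} (hZ : Z * S = β * Z + vecMulVec σ y) : y = 0 := by
  obtain ⟨c, hc⟩ := h.exists_dual fun k => if (k : ℕ) + 1 = s then 1 else 0
  have hstep : ∀ k : ℕ, (c ᵥ* (β ^ k * Z)) ᵥ* S =
      c ᵥ* (β ^ (k + 1) * Z) + (c ⬝ᵥ ((β ^ k) *ᵥ σ)) • y := by
    intro k
    rw [Matrix.vecMul_vecMul, Matrix.mul_assoc, hZ, Matrix.mul_add, Matrix.vecMul_add,
      ← Matrix.mul_assoc, ← pow_succ, Matrix.mul_vecMulVec, Matrix.vecMul_vecMulVec]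
  have hlow : ∀ k < s, c ᵥ* (Z * S ^ k) = c ᵥ* (β ^ k * Z) := by
    intro k hk
    induction k with
    | zero => simp
    | succ k ih =>
      rw [pow_succ, ← Matrix.mul_assoc, ← Matrix.vecMul_vecMul, ih (by omega), hstep,
        hc ⟨k, by omega⟩, if_neg (by simp; omega), zero_smul, add_zero]
  have htop : c ᵥ* (Z * S ^ s) = c ᵥ* (β ^ s * Z) + y := by
    obtain ⟨k, rfl⟩ : ∃ k, s = k + 1 := ⟨s - 1, by omega⟩
    rw [pow_succ, ← Matrix.mul_assoc, ← Matrix.vecMul_vecMul, hlow k (by omega), hstep,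
      hc ⟨k, by omega⟩, if_pos rfl, one_smul]
  have h1 : c ᵥ* (Z * Polynomial.aeval S m) = 0 := by rw [hS]; simp
  have h2 : c ᵥ* (Polynomial.aeval β m * Z) = 0 := by rw [hβ]; simp
  have hcoeff : m.coeff s = 1 := hdeg ▸ hm
  rw [Polynomial.aeval_eq_sum_range, hdeg, Finset.sum_range_succ, hcoeff, one_smul,
    Matrix.mul_add, Matrix.vecMul_add, htop, Matrix.mul_sum] at h1
  rw [Polynomial.aeval_eq_sum_range, hdeg, Finset.sum_range_succ, hcoeff, one_smul,
    Matrix.add_mul, Matrix.vecMul_add, Matrix.sum_mul] at h2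
  have h3 : c ᵥ* (∑ i ∈ Finset.range s, Z * m.coeff i • S ^ i) =
      c ᵥ* (∑ i ∈ Finset.range s, m.coeff i • β ^ i * Z) := by
    have hsum : ∀ f : ℕ → Matrix (Fin s) γ ℝ, c ᵥ* (∑ i ∈ Finset.range s, f i) =
        ∑ i ∈ Finset.range s, c ᵥ* f i := fun f => by
      ext j
      simp only [Matrix.vecMul, dotProduct, Matrix.sum_apply, Finset.sum_apply, Finset.mul_sum]
      exact Finset.sum_comm
    rw [hsum, hsum]
    refine Finset.sum_congr rfl fun i hi => ?_
    rw [Matrix.mul_smul, Matrix.smul_mul, Matrix.vecMul_smul, Matrix.vecMul_smul,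
      hlow i (Finset.mem_range.1 hi)]
  rw [h3, ← add_assoc, h2, zero_add] at h1
  exact h1

/-- Take multiplication by the root in ℝ[X]/(m), in the power basis, and the coordinates of 1. The
Kalman matrix is then the identity. -/
theorem exists_isControllable_charpoly_eq {m : Polynomial ℝ} (hm : m.Monic) {s : ℕ}
    (hs : m.natDegree = s) :
    ∃ (β : Matrix (Fin s) (Fin s) ℝ) (σ : Fin s → ℝ), IsControllable β σ ∧ β.charpoly = m := by
  set pb := AdjoinRoot.powerBasis hm.ne_zero
  have hdim : pb.dim = s := hs
  subst hdim
  refine ⟨Algebra.leftMulMatrix pb.basis pb.gen, pb.basis.repr 1, ?_, ?_⟩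
  · have : (Matrix.of fun a (k : Fin pb.dim) =>
        ((Algebra.leftMulMatrix pb.basis pb.gen ^ (k : ℕ)) *ᵥ pb.basis.repr 1) a) = 1 := by
      ext a k
      rw [Matrix.of_apply, ← map_pow, Algebra.leftMulMatrix_mulVec_repr, mul_one,
        ← pb.basis_eq_pow, Module.Basis.repr_self, Finsupp.single_apply, Matrix.one_apply]
      simp only [eq_comm]
    rw [IsControllable, this, Matrix.rank_one, Fintype.card_fin]
  · rw [charpoly_leftMulMatrix, AdjoinRoot.minpoly_powerBasis_gen_of_monic hm]

end Controllable

/-! ### Internal models: regulation, modes and existence -/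

section InternalModel

variable {α γ : Type*} [Fintype α] [DecidableEq α] [Fintype γ] [DecidableEq γ] {p : ℕ}
  {S : Matrix γ γ ℝ} {M₁ : Matrix α α ℝ} {M₂ : Matrix α (Fin p) ℝ}

theorem minpolyOrder_pos [Nonempty γ] (S : Matrix γ γ ℝ) : 0 < minpolyOrder S :=
  minpoly.natDegree_pos (Matrix.isIntegral S)

theorem blockDiagonal_mul_apply {γ : Type*} {p s : ℕ} (β : Fin p → Matrix (Fin s) (Fin s) ℝ)
    (Z : Matrix (Fin s × Fin p) γ ℝ) (a : Fin s) (l : Fin p) (c : γ) :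
    (blockDiagonal β * Z) (a, l) c = (β l * Matrix.of fun a c => Z (a, l) c) a c := by
  simp [Matrix.mul_apply, Fintype.sum_prod_type, blockDiagonal_apply]

/-- If an internal model is driven by `Y` and its response lies in the steady state of the
exosystem then `Y` vanishes. -/
theorem IncorporatesInternalModel.regulator [Nonempty γ] (h : IncorporatesInternalModel S M₁ M₂)
    {Z : Matrix α γ ℝ} {Y : Matrix (Fin p) γ ℝ} (hZ : Z * S = M₁ * Z + M₂ * Y) : Y = 0 := by
  obtain ⟨β, σ, hβ, k, T₁, T₂, T₃, V, W, hVW, hWV, rfl, rfl⟩ := h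
  have h1 : W * Z * S = fromBlocks T₁ T₂ 0 (blockDiagonal β) * (W * Z) +
      fromRows T₃ (columnBlocks σ) * Y := by
    rw [Matrix.mul_assoc, hZ, Matrix.mul_add]
    simp only [← Matrix.mul_assoc, hWV, Matrix.one_mul]
  rw [← Matrix.fromRows_toRows (W * Z), Matrix.fromRows_mul, Matrix.fromBlocks_mul_fromRows,
    Matrix.fromRows_mul] at h1
  have h2 := congrArg Matrix.toRows₂ h1
  set Z' := (W * Z).toRows₂
  have h3 : Z' * S = blockDiagonal β * Z' + columnBlocks σ * Y := by
    ext i j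
    have := congrFun (congrFun h2 i) j
    simpa [Matrix.toRows₂] using this
  ext l d
  have key := (hβ l).1.regulator (minpolyOrder_pos S) (minpoly.monic (Matrix.isIntegral S)) rfl
    (by rw [← (hβ l).2, Matrix.aeval_self_charpoly]) (minpoly.aeval ℝ S)
    (Z := Matrix.of fun a c => Z' (a, l) c) (y := Y l) (by
      ext a c
      have := congrFun (congrFun h3 (a, l)) c
      rw [Matrix.add_apply, blockDiagonal_mul_apply] at this
      rw [Matrix.add_apply, ← sub_eq_iff_eq_add'] at *
      rw [vecMulVec_apply]
      refine Eq.trans ?_ (this.trans ?_)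
      · rfl
      · simp [columnBlocks, Matrix.mul_apply])
  exact congrFun key d

/-- A left eigenvector of an internal model of full size splits into left eigenvectors of
its blocks. -/
theorem IncorporatesInternalModel.exists_block_eigenvector
    (h : IncorporatesInternalModel S M₁ M₂) (hcard : Fintype.card α = p * minpolyOrder S)
    {z : ℂ} {v : α → ℂ} (hv : v ≠ 0) (hvz : v ᵥ* M₁.map Complex.ofReal = z • v) :
    ∃ (β : Matrix (Fin (minpolyOrder S)) (Fin (minpolyOrder S)) ℝ)
      (σ : Fin (minpolyOrder S) → ℝ) (u : Fin (minpolyOrder S) → ℂ), IsControllable β σ ∧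
      β.charpoly = minpoly ℝ S ∧ u ≠ 0 ∧ u ᵥ* β.map Complex.ofReal = z • u ∧
      (v ᵥ* M₂.map Complex.ofReal = 0 → u ⬝ᵥ (fun a => (σ a : ℂ)) = 0) := by
  obtain ⟨β, σ, hβ, k, T₁, T₂, T₃, V, W, hVW, hWV, rfl, rfl⟩ := h
  -- The size of the model leaves no room for the `T` blocks, which could otherwise contribute modes
  -- foreign to `S`.
  have hk : k = 0 := by
    let e : (α → ℝ) ≃ₗ[ℝ] (Fin k ⊕ (Fin (minpolyOrder S) × Fin p) → ℝ) :=
      Matrix.toLin'OfInv hVW hWV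
    have := e.finrank_eq
    simp only [Module.finrank_fintype_fun_eq_card, Fintype.card_sum, Fintype.card_fin,
      Fintype.card_prod, hcard] at this
    nlinarith
  subst hk
  set u := v ᵥ* V.map Complex.ofReal with hu
  have hu0 : u ≠ 0 := by
    intro h0
    apply hv
    have := congrArg (fun t => t ᵥ* W.map Complex.ofReal) h0
    simpa [hu, Matrix.vecMul_vecMul, ← map_mul_ofReal, hVW, map_one_ofReal] using this
  have huz : u ᵥ* (fromBlocks T₁ T₂ 0 (blockDiagonal β)).map Complex.ofReal = z • u := by
    have := congrArg (fun t => t ᵥ* V.map Complex.ofReal) hvz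
    simp only [Matrix.vecMul_vecMul, ← map_mul_ofReal, Matrix.mul_assoc, hWV, Matrix.mul_one,
      Matrix.smul_vecMul] at this
    rw [map_mul_ofReal, ← Matrix.vecMul_vecMul] at this
    exact this
  obtain ⟨i, hi⟩ := Function.ne_iff.1 hu0
  rcases i with i | ⟨a, l⟩
  · exact i.elim0
  refine ⟨β l, σ l, fun a => u (Sum.inr (a, l)), (hβ l).1, (hβ l).2,
    fun h0 => hi (congrFun h0 a), ?_, fun h2 => ?_⟩
  · ext b
    have := congrFun huz (Sum.inr (b, l))
    simpa [Matrix.vecMul, dotProduct, Fintype.sum_prod_type, blockDiagonal_apply, apply_ite] using this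
  · rw [map_mul_ofReal, ← Matrix.vecMul_vecMul] at h2
    rw [← hu] at h2
    clear_value u
    have := congrFun h2 l
    simpa [Matrix.vecMul, dotProduct, Fintype.sum_prod_type, columnBlocks, apply_ite] using this

theorem mem_spec_iff_aeval_charpoly (M : Matrix α α ℝ) {z : ℂ} :
    z ∈ spec M ↔ Polynomial.aeval z M.charpoly = 0 := by
  rw [spec, Matrix.mem_spectrum_iff_isRoot_charpoly, Polynomial.IsRoot,
    show M.map Complex.ofReal = M.map Complex.ofRealHom from rfl, Matrix.charpoly_map,
    Polynomial.eval_map]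
  rfl

theorem IncorporatesInternalModel.spec_subset (h : IncorporatesInternalModel S M₁ M₂)
    (hcard : Fintype.card α = p * minpolyOrder S) : spec M₁ ⊆ spec S := by
  intro z hz
  obtain ⟨v, hv, hvz⟩ := mem_spec_iff_exists_vecMul.1 hz
  obtain ⟨β, σ, u, -, hβ, hu, huz, -⟩ := h.exists_block_eigenvector hcard hv hvz
  have h1 : z ∈ spec β := mem_spec_iff_exists_vecMul.2 ⟨u, hu, huz⟩
  rw [mem_spec_iff_aeval_charpoly] at h1 ⊢
  rw [hβ] at h1
  obtain ⟨q, hq⟩ := Matrix.minpoly_dvd_charpoly S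
  rw [hq, map_mul, h1, zero_mul]

theorem IncorporatesInternalModel.eq_zero_of_vecMul (h : IncorporatesInternalModel S M₁ M₂)
    (hcard : Fintype.card α = p * minpolyOrder S) {z : ℂ} {v : α → ℂ}
    (h1 : v ᵥ* M₁.map Complex.ofReal = z • v) (h2 : v ᵥ* M₂.map Complex.ofReal = 0) : v = 0 := by
  by_contra hv
  obtain ⟨β, σ, u, hc, -, hu, huz, hσ⟩ := h.exists_block_eigenvector hcard hv h1
  exact hu (hc.eq_zero_of_vecMul huz (hσ h2))

theorem exists_incorporatesInternalModel (S : Matrix γ γ ℝ) (p : ℕ)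
    (hcard : Fintype.card α = p * minpolyOrder S) :
    ∃ (M₁ : Matrix α α ℝ) (M₂ : Matrix α (Fin p) ℝ), IncorporatesInternalModel S M₁ M₂ := by
  obtain ⟨β, σ, h1, h2⟩ := exists_isControllable_charpoly_eq
    (minpoly.monic (Matrix.isIntegral S)) (rfl : _ = minpolyOrder S)
  let e : α ≃ Fin 0 ⊕ (Fin (minpolyOrder S) × Fin p) := Fintype.equivOfCardEq (by
    simp [hcard, mul_comm])
  refine ⟨_, _, fun _ => β, fun _ => σ, fun _ => ⟨h1, h2⟩, 0, 0, 0, 0,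
    (1 : Matrix _ _ ℝ).submatrix e id, (1 : Matrix _ _ ℝ).submatrix id e, ?_, ?_, rfl, rfl⟩
  · rw [← Matrix.submatrix_mul _ _ _ _ _ Function.bijective_id, Matrix.one_mul]
    exact Matrix.submatrix_one_equiv e
  · rw [Matrix.submatrix_mul_equiv]
    simp

end InternalModel

/-! ### A single agent with its controller -/

section Blocks

variable {α β : Type*} [Fintype α] [DecidableEq α] [Fintype β] [DecidableEq β]

theorem map_zero_ofReal {l m : Type*} : (0 : Matrix l m ℝ).map Complex.ofReal = 0 :=
  Matrix.map_zero _ Complex.ofReal_zero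

theorem spec_fromBlocks_zero_subset (A : Matrix α α ℝ) (B : Matrix α β ℝ) (D : Matrix β β ℝ) :
    spec (fromBlocks A B 0 D) ⊆ spec A ∪ spec D := by
  intro z hz
  obtain ⟨v, hv, hvz⟩ := mem_spec_iff_exists_mulVec.1 hz
  rw [Matrix.fromBlocks_map, map_zero_ofReal, Matrix.fromBlocks_mulVec, Matrix.zero_mulVec,
    zero_add] at hvz
  have h2 : D.map Complex.ofReal *ᵥ (v ∘ Sum.inr) = z • (v ∘ Sum.inr) :=
    funext fun i => congrFun hvz (Sum.inr i)
  have h1 : A.map Complex.ofReal *ᵥ (v ∘ Sum.inl) + B.map Complex.ofReal *ᵥ (v ∘ Sum.inr) =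
      z • (v ∘ Sum.inl) := funext fun i => congrFun hvz (Sum.inl i)
  by_cases h : v ∘ Sum.inr = 0
  · left
    rw [h, Matrix.mulVec_zero, add_zero] at h1
    refine mem_spec_iff_exists_mulVec.2 ⟨_, fun h' => hv ?_, h1⟩
    rw [← Sum.elim_comp_inl_inr v, h, h', Sum.elim_zero_zero]
  · exact Or.inr (mem_spec_iff_exists_mulVec.2 ⟨_, h, h2⟩)

theorem IsHurwitz.fromBlocks_zero {A : Matrix α α ℝ} {D : Matrix β β ℝ} (hA : IsHurwitz A)
    (hD : IsHurwitz D) (B : Matrix α β ℝ) : IsHurwitz (fromBlocks A B 0 D) :=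
  fun z hz => (spec_fromBlocks_zero_subset A B D hz).elim (hA z) (hD z)

theorem spec_zero_subset : spec (0 : Matrix α α ℝ) ⊆ {0} := by
  intro z hz
  obtain ⟨v, hv, hvz⟩ := mem_spec_iff_exists_mulVec.1 hz
  rw [map_zero_ofReal, Matrix.zero_mulVec, eq_comm, smul_eq_zero] at hvz
  exact hvz.resolve_right hv

end Blocks

section Agent

variable {n m p q : ℕ} {α : Type*} [Fintype α] [DecidableEq α]

/-- The gain for the augmented plant: stabilize the plant first, then the internal model. -/
theorem exists_stabilizing_gain {γ : Type*} [Fintype γ] [DecidableEq γ] {S : Matrix γ γ ℝ}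
    {A : Matrix (Fin n) (Fin n) ℝ} {B : Matrix (Fin n) (Fin m) ℝ} {C : Matrix (Fin p) (Fin n) ℝ}
    {Γ : Matrix (Fin p) (Fin p) ℝ} {G₁ : Matrix α α ℝ} {G₂ : Matrix α (Fin p) ℝ}
    (hstab : IsStabilizable A B) (hΓ : IsUnit Γ) (hG : IncorporatesInternalModel S G₁ G₂)
    (hcard : Fintype.card α = p * minpolyOrder S) (hS : ∀ z ∈ spec S, 0 ≤ z.re)
    (hrank : ∀ z ∈ spec S, (Matrix.fromBlocks (A.map Complex.ofReal - z • 1)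
      (B.map Complex.ofReal) (C.map Complex.ofReal) 0).rank = n + p) :
    ∃ K : Matrix (Fin m) (Fin n ⊕ α) ℝ,
      IsHurwitz (fromBlocks (A + B * K.toCols₁) (B * K.toCols₂) (G₂ * (Γ * C)) G₁) := by
  obtain ⟨K₀, hK₀⟩ := hstab
  have hG₁ : ∀ z ∈ spec G₁, 0 ≤ z.re := fun z hz => hS z (hG.spec_subset hcard hz)
  -- The model's modes lie in the closed right half-plane and those of `A + B * K₀` in the open left
  -- one. With `X`, the coordinate ζ + Xx of the model (state ζ, plant state x) no longer sees the
  -- plant state, only the input through `X * B`.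
  obtain ⟨X, hX⟩ := exists_sylvester (Set.disjoint_left.2 fun z h1 h2 =>
    (hG₁ z h1).not_gt (hK₀ z h2)) (G₂ * (Γ * C))
  obtain ⟨K', hK'⟩ := exists_isHurwitz_of_pbh (B := X * B) hG₁ (by
    intro z v hv hvB
    by_contra hv0
    have hz : z ∈ spec S := hG.spec_subset hcard (mem_spec_iff_exists_vecMul.2 ⟨v, hv0, hv⟩)
    have hB : (v ᵥ* X.map Complex.ofReal) ᵥ* B.map Complex.ofReal = 0 := by
      rwa [Matrix.vecMul_vecMul, ← map_mul_ofReal]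
    have hXA : (v ᵥ* X.map Complex.ofReal) ᵥ* A.map Complex.ofReal =
        z • (v ᵥ* X.map Complex.ofReal) - v ᵥ* (G₂ * (Γ * C)).map Complex.ofReal := by
      rw [← hX, map_sub_ofReal, map_mul_ofReal, map_mul_ofReal, Matrix.vecMul_sub,
        ← Matrix.vecMul_vecMul, hv, Matrix.smul_vecMul, sub_sub_cancel, map_add_ofReal,
        map_mul_ofReal, ← Matrix.vecMul_vecMul, Matrix.vecMul_add, ← Matrix.vecMul_vecMul, hB,
        Matrix.zero_vecMul, add_zero]
    -- The row vector (vX, vG₂Γ) annihilates the full-rank matrix at the exosystem frequency `z`.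
    -- Hence vG₂Γ = 0, so vG₂ = 0, and the internal model has no such uncontrollable mode.
    have h0 := eq_zero_of_vecMul_eq_zero_of_rank_eq
      (M := Matrix.fromBlocks (A.map Complex.ofReal - z • 1) (B.map Complex.ofReal)
        (C.map Complex.ofReal) 0) (by simpa using hrank z hz)
      (v := Sum.elim (v ᵥ* X.map Complex.ofReal) (v ᵥ* (G₂ * Γ).map Complex.ofReal)) (by
        rw [Matrix.vecMul_fromBlocks, Sum.elim_comp_inl, Sum.elim_comp_inr, hB, Matrix.vecMul_sub,
          hXA, Matrix.vecMul_smul, Matrix.vecMul_one, Matrix.vecMul_vecMul, ← map_mul_ofReal,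
          Matrix.mul_assoc]
        simp)
    have h1 : v ᵥ* (G₂ * Γ).map Complex.ofReal = 0 := funext fun i => congrFun h0 (Sum.inr i)
    refine hv0 (hG.eq_zero_of_vecMul hcard hv ?_)
    have := congrArg (fun u => u ᵥ* (Γ⁻¹).map Complex.ofReal) h1
    simpa only [Matrix.vecMul_vecMul, ← map_mul_ofReal, Matrix.mul_assoc,
      Matrix.mul_nonsing_inv Γ ((Matrix.isUnit_iff_isUnit_det Γ).1 hΓ), Matrix.mul_one,
      Matrix.zero_vecMul] using this)
  refine ⟨fromCols (K₀ + K' * X) K', fun z hz => ?_⟩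
  rw [Matrix.toCols₁_fromCols, Matrix.toCols₂_fromCols] at hz
  refine hK₀.fromBlocks_zero hK' (B * K') z (spec_conj _ _ (fromBlocks 1 0 (-X) 1)
    (fromBlocks 1 0 X 1) ?_ ?_ hz)
  · simp [Matrix.fromBlocks_multiply]
  · simp only [Matrix.fromBlocks_multiply, ← hX, Matrix.mul_one, Matrix.one_mul, Matrix.mul_zero,
      Matrix.zero_mul, add_zero, zero_add]
    congr 1
    · simp [Matrix.mul_add, Matrix.mul_assoc, add_assoc]
    · rw [Matrix.mul_neg, Matrix.neg_mul]; abel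
    · simp [Matrix.mul_assoc]

/-- The separation principle: with the observer error as a coordinate, the nominal closed loop of
an agent is block triangular. -/
theorem isHurwitz_agent_loop {A : Matrix (Fin n) (Fin n) ℝ} {B : Matrix (Fin n) (Fin m) ℝ}
    {H : Matrix (Fin p) (Fin n) ℝ} {G₁ : Matrix α α ℝ} {G₂ : Matrix α (Fin p) ℝ}
    {L : Matrix (Fin n) (Fin p) ℝ} {K : Matrix (Fin m) (Fin n ⊕ α) ℝ}
    (hL : IsHurwitz (A - L * H))
    (hK : IsHurwitz (fromBlocks (A + B * K.toCols₁) (B * K.toCols₂) (G₂ * H) G₁)) :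
    IsHurwitz (fromBlocks A (B * K) (fromRows L G₂ * H)
      (fromBlocks (A + B * K.toCols₁ - L * H) (B * K.toCols₂) 0 G₁)) := by
  intro z hz
  obtain ⟨v, hv, hvz⟩ := mem_spec_iff_exists_mulVec.1 hz
  set K₁ := K.toCols₁ with hK₁
  set K₂ := K.toCols₂ with hK₂
  have hKK : K = fromCols K₁ K₂ := (Matrix.fromCols_toCols K).symm
  obtain ⟨x, ξ, ζ, rfl⟩ : ∃ x ξ ζ, v = Sum.elim x (Sum.elim ξ ζ) :=
    ⟨v ∘ Sum.inl, v ∘ Sum.inr ∘ Sum.inl, v ∘ Sum.inr ∘ Sum.inr, by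
      ext (i | i | i) <;> rfl⟩
  rw [hKK] at hvz
  have hcols : (B * fromCols K₁ K₂).map Complex.ofReal =
      fromCols ((B * K₁).map Complex.ofReal) ((B * K₂).map Complex.ofReal) := by
    rw [Matrix.mul_fromCols]; ext i (j | j) <;> rfl
  have hrows : (fromRows L G₂ * H).map Complex.ofReal =
      fromRows ((L * H).map Complex.ofReal) ((G₂ * H).map Complex.ofReal) := by
    rw [Matrix.fromRows_mul]; ext (i | i) j <;> rfl
  simp only [Matrix.fromBlocks_map, hcols, hrows, map_zero_ofReal, Matrix.fromBlocks_mulVec,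
    Sum.elim_comp_inl, Sum.elim_comp_inr, Matrix.fromCols_mulVec, Matrix.fromRows_mulVec,
    Matrix.zero_mulVec, zero_add] at hvz
  have h1 : A.map Complex.ofReal *ᵥ x + ((B * K₁).map Complex.ofReal *ᵥ ξ +
      (B * K₂).map Complex.ofReal *ᵥ ζ) = z • x := funext fun i => congrFun hvz (Sum.inl i)
  have h2 : (L * H).map Complex.ofReal *ᵥ x + ((A + B * K₁ - L * H).map Complex.ofReal *ᵥ ξ +
      (B * K₂).map Complex.ofReal *ᵥ ζ) = z • ξ :=
    funext fun i => congrFun hvz (Sum.inr (Sum.inl i))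
  have h3 : (G₂ * H).map Complex.ofReal *ᵥ x + G₁.map Complex.ofReal *ᵥ ζ = z • ζ :=
    funext fun i => congrFun hvz (Sum.inr (Sum.inr i))
  -- A nonzero observer error is an eigenvector of `A - L * H`; if it vanishes, `x` and `ζ` form an
  -- eigenvector of the augmented plant.
  by_cases he : x = ξ
  · subst he
    refine hK z (mem_spec_iff_exists_mulVec.2 ⟨Sum.elim x ζ, fun h0 => hv ?_, ?_⟩)
    · have hx : x = 0 := funext fun i => congrFun h0 (Sum.inl i)
      have hζ : ζ = 0 := funext fun i => congrFun h0 (Sum.inr i)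
      rw [hx, hζ, Sum.elim_zero_zero, Sum.elim_zero_zero]
    · rw [Matrix.fromBlocks_map, Matrix.fromBlocks_mulVec, Sum.elim_comp_inl, Sum.elim_comp_inr,
        h3, map_add_ofReal, Matrix.add_mulVec, add_assoc, h1]
      ext (i | i) <;> rfl
  · refine hL z (mem_spec_iff_exists_mulVec.2 ⟨x - ξ, sub_ne_zero.2 he, ?_⟩)
    rw [smul_sub, ← h1, ← h2]
    simp only [map_sub_ofReal, map_add_ofReal, Matrix.sub_mulVec, Matrix.add_mulVec,
      Matrix.mulVec_sub]
    abel

/-- An agent whose closed loop is stable regulates its tracking error `H x + v` to zero if the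
error that drives its controller is perturbed by a vanishing signal. -/
theorem tendsto_agent_error {S : Matrix (Fin q) (Fin q) ℝ}
    {A : Matrix (Fin n) (Fin n) ℝ} {BK : Matrix (Fin n) (Fin n ⊕ α) ℝ}
    {P : Matrix (Fin n) (Fin q) ℝ} {H : Matrix (Fin p) (Fin n) ℝ} {N₁ : Matrix (Fin n) (Fin n) ℝ}
    {N₂ : Matrix (Fin n) α ℝ} {L : Matrix (Fin n) (Fin p) ℝ} {G₁ : Matrix α α ℝ}
    {G₂ : Matrix α (Fin p) ℝ} (hS : ∀ z ∈ spec S, 0 ≤ z.re)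
    (hG : IncorporatesInternalModel (fromBlocks S 0 0 (0 : Matrix (Fin 1) (Fin 1) ℝ)) G₁ G₂)
    (hF : IsHurwitz (fromBlocks A BK (fromRows L G₂ * H) (fromBlocks N₁ N₂ 0 G₁)))
    {w : ℝ → Fin q → ℝ} {x : ℝ → Fin n → ℝ} {η : ℝ → Fin n ⊕ α → ℝ} {d : ℝ → Fin p → ℝ}
    (v : Fin p → ℝ)
    (hw : ∀ t ∈ Set.Ici (0 : ℝ), HasDerivWithinAt w (S *ᵥ w t) (Set.Ici 0) t)
    (hx : ∀ t ∈ Set.Ici (0 : ℝ),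
      HasDerivWithinAt x (A *ᵥ x t + BK *ᵥ η t + P *ᵥ w t) (Set.Ici 0) t)
    (hη : ∀ t ∈ Set.Ici (0 : ℝ), HasDerivWithinAt η
      (fromBlocks N₁ N₂ 0 G₁ *ᵥ η t + fromRows L G₂ *ᵥ (H *ᵥ x t + v + d t)) (Set.Ici 0) t)
    (hd : Tendsto d atTop (𝓝 0)) :
    Tendsto (fun t => H *ᵥ x t + v) atTop (𝓝 0) := by
  set St := fromBlocks S 0 0 (0 : Matrix (Fin 1) (Fin 1) ℝ)
  set M₁ := fromBlocks N₁ N₂ 0 G₁ with hM₁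
  set M₂ := fromRows L G₂ with hM₂
  set F := fromBlocks A BK (M₂ * H) M₁ with hFdef
  set c : Matrix (Fin p) (Fin 1) ℝ := Matrix.of fun i _ => v i
  have hSt : ∀ z ∈ spec St, 0 ≤ z.re := by
    intro z hz
    rcases spec_fromBlocks_zero_subset _ _ _ hz with h | h
    · exact hS z h
    · rw [spec_zero_subset h]; rfl
  set E : Matrix (Fin n ⊕ (Fin n ⊕ α)) (Fin q ⊕ Fin 1) ℝ := fromBlocks P 0 0 (M₂ * c) with hE
  -- The steady state is `X *ᵥ ω`, where `ω` is the exosystem state extended by the constant 1. It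
  -- exists because `F` is Hurwitz and `St` has no eigenvalue with negative real part.
  obtain ⟨X, hX⟩ := exists_sylvester
    (Set.disjoint_left.2 fun z h1 h2 => (hSt z h2).not_gt (hF z h1)) (-E)
  set H₀ : Matrix (Fin p) (Fin n ⊕ (Fin n ⊕ α)) ℝ := fromCols H 0 with hH₀
  set c₀ : Matrix (Fin p) (Fin q ⊕ Fin 1) ℝ := fromCols 0 c with hc₀
  set Y : Matrix (Fin p) (Fin q ⊕ Fin 1) ℝ := H₀ * X + c₀ with hY
  -- `Y` is the tracking error on the steady state. The last block row of the Sylvester equation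
  -- says that the internal model, driven by `Y`, responds within the modes of `St`.
  have hY0 : Y = 0 := by
    refine hG.regulator (Z := X.toRows₂.toRows₂) ?_
    have h1 : X * St = F * X + E := by rw [sub_eq_iff_eq_add.1 hX]; abel
    have hXX : X = fromRows X.toRows₁ (fromRows X.toRows₂.toRows₁ X.toRows₂.toRows₂) := by
      rw [Matrix.fromRows_toRows, Matrix.fromRows_toRows]
    have hEE : E = fromRows (fromCols P 0) (fromRows (L * c₀) (G₂ * c₀)) := by
      rw [hE, ← Matrix.fromRows_fromCols_eq_fromBlocks, ← Matrix.fromRows_mul, hc₀,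
        Matrix.mul_fromCols, Matrix.mul_zero]
    have hYX : Y = H * X.toRows₁ + c₀ := by
      rw [hY, hH₀, ← Matrix.fromRows_toRows X, Matrix.fromCols_mul_fromRows, Matrix.zero_mul, add_zero,
        Matrix.toRows₁_fromRows]
    have h2 := congrArg (fun N => N.toRows₂.toRows₂) h1
    rw [hEE, hXX, hFdef, Matrix.fromBlocks_mul_fromRows, hM₁, Matrix.fromBlocks_mul_fromRows, hM₂,
      Matrix.fromRows_mul, Matrix.fromRows_mul, Matrix.fromRows_mul, Matrix.fromRows_mul] at h2
    rw [hYX]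
    ext i j
    have h3 := congrFun (congrFun h2 i) j
    simp only [Matrix.toRows₂_apply, Matrix.fromRows_apply_inr, Matrix.add_apply, Matrix.zero_mul,
      zero_add, Matrix.toRows₂_fromRows] at h3
    rw [h3, Matrix.mul_add, ← Matrix.mul_assoc, Matrix.add_apply, Matrix.add_apply]
    ring
  set ω : ℝ → Fin q ⊕ Fin 1 → ℝ := fun t => Sum.elim (w t) 1 with hω
  set χ : ℝ → Fin n ⊕ (Fin n ⊕ α) → ℝ := fun t => Sum.elim (x t) (η t) with hχ
  have hω' : ∀ t ∈ Set.Ici (0 : ℝ), HasDerivWithinAt ω (St *ᵥ ω t) (Set.Ici 0) t := by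
    intro t ht
    rw [hasDerivWithinAt_pi]
    rintro (i | i)
    · simpa [hω, St, Matrix.fromBlocks_mulVec, Function.comp_def] using
        hasDerivWithinAt_pi.1 (hw t ht) i
    · simpa [hω, St, Matrix.fromBlocks_mulVec] using hasDerivWithinAt_const t (Set.Ici 0) (1 : ℝ)
  have hc : c *ᵥ 1 = v := by ext i; simp [c, Matrix.mulVec, dotProduct]
  have hχ' : ∀ t ∈ Set.Ici (0 : ℝ), HasDerivWithinAt χ
      (F *ᵥ χ t + E *ᵥ ω t + Sum.elim (0 : Fin n → ℝ) (M₂ *ᵥ d t)) (Set.Ici 0) t := by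
    intro t ht
    rw [hasDerivWithinAt_pi]
    have hval : F *ᵥ χ t + E *ᵥ ω t + Sum.elim (0 : Fin n → ℝ) (M₂ *ᵥ d t) =
        Sum.elim (A *ᵥ x t + BK *ᵥ η t + P *ᵥ w t) (M₁ *ᵥ η t + M₂ *ᵥ (H *ᵥ x t + v + d t)) := by
      rw [hFdef, hE, Matrix.fromBlocks_mulVec A, Matrix.fromBlocks_mulVec P, hχ, hω]
      simp only [Sum.elim_comp_inl, Sum.elim_comp_inr, Matrix.zero_mulVec, add_zero, zero_add,
        ← Matrix.mulVec_mulVec, hc, Matrix.mulVec_add]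
      ext (i | i)
      · simp
      · simp; ring
    rw [hval]
    rintro (i | i)
    · exact hasDerivWithinAt_pi.1 (hx t ht) i
    · exact hasDerivWithinAt_pi.1 (hη t ht) i
  have hε : Tendsto (fun t => χ t - X *ᵥ ω t) atTop (𝓝 0) := by
    refine hF.tendsto_zero (d := fun t => Sum.elim (0 : Fin n → ℝ) (M₂ *ᵥ d t)) (fun t ht => ?_) ?_
    · refine ((hχ' t ht).sub ((hω' t ht).matrix_mulVec X)).congr_deriv ?_
      have h1 : (F * X) *ᵥ ω t = (X * St) *ᵥ ω t - E *ᵥ ω t := by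
        rw [sub_eq_iff_eq_add.1 hX, Matrix.add_mulVec, Matrix.neg_mulVec]; abel
      rw [Matrix.mulVec_sub, Matrix.mulVec_mulVec, Matrix.mulVec_mulVec, h1]
      abel
    · have := hd.matrix_mulVec_zero M₂
      rw [tendsto_pi_nhds] at this ⊢
      rintro (i | i)
      · exact tendsto_const_nhds
      · exact this i
  have hfin := hε.matrix_mulVec_zero H₀
  refine hfin.congr fun t => ?_
  have h1 : H₀ *ᵥ (X *ᵥ ω t) = -v := by
    have h2 := congrArg (fun N => N *ᵥ ω t) hY0
    rw [hY, Matrix.add_mulVec, Matrix.zero_mulVec, ← Matrix.mulVec_mulVec] at h2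
    rw [eq_neg_of_add_eq_zero_left h2, hc₀, Matrix.fromCols_mulVec]
    simp [hω, hc]
  rw [Matrix.mulVec_sub, h1, hH₀, Matrix.fromCols_mulVec, hχ]
  simp

end Agent

/-! ### The network game -/

section Sigma

theorem mulVec_sigma_apply {R ι : Type*} [Semiring R] [Fintype ι] {k l : ι → Type*}
    [∀ i, Fintype (l i)] (M : Matrix (Σ i, k i) (Σ i, l i) R) (v : (Σ i, l i) → R) (i : ι)
    (a : k i) : (M *ᵥ v) ⟨i, a⟩ =
      ∑ j, ((Matrix.of fun a b => M ⟨i, a⟩ ⟨j, b⟩) *ᵥ fun b => v ⟨j, b⟩) a := by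
  simp only [Matrix.mulVec, dotProduct, Matrix.of_apply]
  exact Fintype.sum_sigma _

theorem blockDiagonal'_map_mulVec_apply {ι : Type*} [Fintype ι] [DecidableEq ι] {k l : ι → Type*}
    [∀ i, Fintype (l i)] (M : ∀ i, Matrix (k i) (l i) ℝ) (v : (Σ i, l i) → ℂ) (i : ι) (a : k i) :
    ((blockDiagonal' M).map Complex.ofReal *ᵥ v) ⟨i, a⟩ =
      ((M i).map Complex.ofReal *ᵥ fun b => v ⟨i, b⟩) a := by
  rw [mulVec_sigma_apply, Finset.sum_eq_single i]
  · simp [Matrix.mulVec, dotProduct, blockDiagonal'_apply_eq]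
  · intro j _ hj
    simp [Matrix.mulVec, dotProduct, blockDiagonal'_apply_ne _ _ _ (Ne.symm hj)]
  · simp

theorem IsPosDef.isUnit {α : Type*} [Fintype α] [DecidableEq α] {M : Matrix α α ℝ}
    (h : IsPosDef M) : IsUnit M := by
  rw [Matrix.isUnit_iff_isUnit_det, isUnit_iff_ne_zero]
  intro hdet
  obtain ⟨v, hv, hMv⟩ := Matrix.exists_mulVec_eq_zero_iff.2 hdet
  have := h v hv
  rw [hMv, dotProduct_zero] at this
  exact this.false

theorem IsPosDef.add_transpose {α : Type*} [Fintype α] {M : Matrix α α ℝ} (h : IsPosDef M) :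
    IsPosDef (M + Mᵀ) := by
  intro x hx
  have h1 : x ⬝ᵥ (Mᵀ *ᵥ x) = x ⬝ᵥ (M *ᵥ x) := by
    rw [Matrix.mulVec_transpose, dotProduct_comm, ← Matrix.dotProduct_mulVec]
  rw [Matrix.add_mulVec, dotProduct_add, h1]
  linarith [h x hx]

end Sigma

namespace NetworkGame

variable {N : ℕ} {g : NetworkGame N}

/-- The Hessian `Rᵢᵢ + Rᵢᵢᵀ` of agent `i`'s cost in its own decision variable. -/
def hess (g : NetworkGame N) (i : Fin N) : Matrix (Fin (g.p i)) (Fin (g.p i)) ℝ :=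
  g.R i i + (g.R i i)ᵀ

theorem isUnit_hess (hR : ∀ i, IsPosDef (g.R i i)) (i : Fin N) : IsUnit (g.hess i) :=
  (hR i).add_transpose.isUnit

theorem Rbar_block_self (i : Fin N) :
    (Matrix.of fun a b => g.Rbar ⟨i, a⟩ ⟨i, b⟩) = g.hess i := by
  ext a b
  simp [Rbar, hess]

theorem Rbar_block_of_ne {i j : Fin N} (h : j ≠ i) :
    (Matrix.of fun a b => g.Rbar ⟨i, a⟩ ⟨j, b⟩) = g.R i j := by
  ext a b
  simp [Rbar, h.symm]

/-- The formula for the partial gradient. -/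
def grad (g : NetworkGame N) (i : Fin N) (y : g.Outputs) : Fin (g.p i) → ℝ :=
  g.hess i *ᵥ y i + g.Q i + ∑ j ∈ Finset.univ.erase i, g.R i j *ᵥ y j

theorem Rbar_mulVec_stack_add_Qbar (y : g.Outputs) (i : Fin N) (a : Fin (g.p i)) :
    (g.Rbar *ᵥ g.stack y + g.Qbar) ⟨i, a⟩ = g.grad i y a := by
  rw [Pi.add_apply, mulVec_sigma_apply, ← Finset.add_sum_erase _ _ (Finset.mem_univ i),
    Rbar_block_self, Finset.sum_congr rfl fun j hj => by
      rw [Rbar_block_of_ne (Finset.ne_of_mem_erase hj)]]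
  simp only [grad, Pi.add_apply, Finset.sum_apply, Qbar, stack]
  ring

theorem Rbar_mulVec_stack_add_Qbar_eq_zero_iff (y : g.Outputs) :
    g.Rbar *ᵥ g.stack y + g.Qbar = 0 ↔ ∀ i, g.grad i y = 0 := by
  constructor
  · intro h i
    ext a
    rw [← Rbar_mulVec_stack_add_Qbar, h]; rfl
  · intro h
    ext ⟨i, a⟩
    rw [Rbar_mulVec_stack_add_Qbar, h]; rfl

/-- The Taylor expansion in an agent's own variable is exact. It yields both the partial gradient
and the sufficiency of the first-order condition. -/
theorem cost_update (i : Fin N) (y : g.Outputs) (h : Fin (g.p i) → ℝ) :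
    g.cost i (Function.update y i (y i + h)) =
      g.cost i y + h ⬝ᵥ g.grad i y + h ⬝ᵥ (g.R i i *ᵥ h) := by
  have hsum : ∑ j ∈ Finset.univ.erase i, ((y i + h) ⬝ᵥ (g.R i j *ᵥ Function.update y i (y i + h) j) +
        Function.update y i (y i + h) j ⬝ᵥ (g.Qoff i j *ᵥ Function.update y i (y i + h) j)) =
      ∑ j ∈ Finset.univ.erase i, (y i ⬝ᵥ (g.R i j *ᵥ y j) + y j ⬝ᵥ (g.Qoff i j *ᵥ y j)) +
        h ⬝ᵥ ∑ j ∈ Finset.univ.erase i, g.R i j *ᵥ y j := by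
    rw [dotProduct_sum, ← Finset.sum_add_distrib]
    refine Finset.sum_congr rfl fun j hj => ?_
    rw [Function.update_of_ne (Finset.ne_of_mem_erase hj), add_dotProduct]
    ring
  have htr : h ⬝ᵥ ((g.R i i)ᵀ *ᵥ y i) = y i ⬝ᵥ (g.R i i *ᵥ h) := by
    rw [Matrix.mulVec_transpose, dotProduct_comm, ← Matrix.dotProduct_mulVec]
  rw [cost, Function.update_self, hsum, cost, grad, hess]
  simp only [Matrix.mulVec_add, Matrix.add_mulVec, dotProduct_add, add_dotProduct, htr,
    dotProduct_comm h (g.Q i)]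
  ring

theorem partialGrad_eq_grad (i : Fin N) (y : g.Outputs) : g.partialGrad i y = g.grad i y := by
  ext k
  have hline : ∀ t : ℝ, Function.update (y i) k t = y i + (t - y i k) • Pi.single k (1 : ℝ) := by
    intro t
    ext l
    by_cases hl : l = k
    · subst hl; simp
    · simp [hl]
  have hcost : (fun t : ℝ => g.cost i (Function.update y i (Function.update (y i) k t))) =
      fun t => g.cost i y + (t - y i k) * g.grad i y k + (t - y i k) ^ 2 * g.R i i k k := by
    funext t
    rw [hline, cost_update]
    simp [Matrix.mulVec_smul]
    ring
  have h1 : HasDerivAt (fun t : ℝ => t - y i k) 1 (y i k) := (hasDerivAt_id _).sub_const _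
  have h2 := ((h1.mul_const (g.grad i y k)).const_add (g.cost i y)).add
    ((h1.pow 2).mul_const (g.R i i k k))
  rw [partialGrad, hcost]
  refine Eq.trans (HasDerivAt.deriv h2) ?_
  simp

theorem isNash_iff (hR : ∀ i, IsPosDef (g.R i i)) (y : g.Outputs) :
    g.IsNash y ↔ g.Rbar *ᵥ g.stack y + g.Qbar = 0 := by
  rw [Rbar_mulVec_stack_add_Qbar_eq_zero_iff]
  constructor
  · intro h i
    rw [← partialGrad_eq_grad]
    ext k
    refine IsLocalMin.deriv_eq_zero (Eventually.of_forall fun t => ?_)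
    simpa using h i (Function.update (y i) k t)
  · intro h i z
    have := cost_update i y (z - y i)
    rw [add_sub_cancel, h, dotProduct_zero, add_zero] at this
    rw [this]
    have : 0 ≤ (z - y i) ⬝ᵥ (g.R i i *ᵥ (z - y i)) := by
      by_cases hz : z - y i = 0
      · simp [hz]
      · exact (hR i _ hz).le
    linarith

theorem existsUnique_equilibrium (hRbar : IsPosDef g.Rbar) :
    ∃! y : g.Outputs, g.Rbar *ᵥ g.stack y + g.Qbar = 0 := by
  have hdet := (Matrix.isUnit_iff_isUnit_det _).1 hRbar.isUnit
  refine ⟨fun i a => (g.Rbar⁻¹ *ᵥ (-g.Qbar)) ⟨i, a⟩, ?_, fun y hy => ?_⟩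
  · change g.Rbar *ᵥ (g.Rbar⁻¹ *ᵥ (-g.Qbar)) + g.Qbar = 0
    rw [Matrix.mulVec_mulVec, Matrix.mul_nonsing_inv _ hdet, Matrix.one_mulVec, neg_add_cancel]
  · have h1 : g.stack y = g.Rbar⁻¹ *ᵥ (-g.Qbar) := by
      rw [← eq_neg_of_add_eq_zero_left hy, Matrix.mulVec_mulVec, Matrix.nonsing_inv_mul _ hdet,
        Matrix.one_mulVec]
    funext i a
    exact congrFun h1 ⟨i, a⟩

/-! ### Choice of the controllers -/

theorem spec_Stilde_subset (i : Fin N) : spec (g.Stilde i) ⊆ spec (g.S i) ∪ {0} :=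
  (spec_fromBlocks_zero_subset _ _ _).trans (Set.union_subset_union_right _ spec_zero_subset)

/-- The Hessian factor in `RC` is invertible, so a detecting gain for `C` only has to be divided by
it. -/
theorem exists_isObserverGain (hR : ∀ i, IsPosDef (g.R i i)) {i : Fin N}
    (hdet : IsDetectable (g.A i) (g.C i)) : ∃ L, g.IsObserverGain i L := by
  obtain ⟨L, hL⟩ := hdet
  refine ⟨L * (g.hess i)⁻¹, ?_⟩
  have : L * (g.hess i)⁻¹ * g.RC i = L * g.C i := by
    change L * (g.hess i)⁻¹ * (g.hess i * g.C i) = _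
    rw [Matrix.mul_assoc, ← Matrix.mul_assoc _ (g.hess i),
      Matrix.nonsing_inv_mul _ ((Matrix.isUnit_iff_isUnit_det _).1 (isUnit_hess hR i)),
      Matrix.one_mul]
  rwa [IsObserverGain, this]

theorem exists_isInternalModel (i : Fin N) : ∃ G₁ G₂, g.IsInternalModel i G₁ G₂ :=
  exists_incorporatesInternalModel (g.Stilde i) (g.p i) (Fintype.card_fin _)

theorem exists_isStabilizingGain (hR : ∀ i, IsPosDef (g.R i i)) {i : Fin N}
    (hS : ∀ z ∈ spec (g.S i), 0 ≤ z.re) (hstab : IsStabilizable (g.A i) (g.B i))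
    (hrank : ∀ z ∈ spec (g.S i) ∪ {0},
      (Matrix.fromBlocks ((g.A i).map Complex.ofReal - z • 1) ((g.B i).map Complex.ofReal)
        ((g.C i).map Complex.ofReal) 0).rank = g.n i + g.p i)
    {G₁ : Matrix (Fin (g.p i * g.s i)) (Fin (g.p i * g.s i)) ℝ}
    {G₂ : Matrix (Fin (g.p i * g.s i)) (Fin (g.p i)) ℝ} (hG : g.IsInternalModel i G₁ G₂) :
    ∃ K, g.IsStabilizingGain i G₁ G₂ K := by
  refine exists_stabilizing_gain hstab (isUnit_hess hR i) hG (Fintype.card_fin _) (fun z hz => ?_)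
    fun z hz => hrank z (spec_Stilde_subset i hz)
  rcases spec_Stilde_subset i hz with h | h
  · exact hS z h
  · rw [h]; rfl

/-! ### The closed loop -/

/-- The closed-loop matrix of agent `i` alone. -/
def agentLoop (κ : ∀ i, g.LocalController i) (μ : g.Uncertainty) (i : Fin N) :
    Matrix (Fin (g.n i) ⊕ g.CtrlIdx i) (Fin (g.n i) ⊕ g.CtrlIdx i) ℝ :=
  fromBlocks (Aμ μ i) (Bμ μ i * (κ i).K) ((κ i).M₂ * (g.hess i * Cμ μ i)) (κ i).M₁

/-- At μ = 0 this is the separation principle; the loop depends continuously on μ and there are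
finitely many agents. -/
theorem eventually_isHurwitz_agentLoop {κ : ∀ i, g.LocalController i}
    (hκ : ∀ i, g.IsObserverGain i (κ i).L ∧ g.IsStabilizingGain i (κ i).G₁ (κ i).G₂ (κ i).K) :
    ∀ᶠ μ : g.Uncertainty in 𝓝 0, ∀ i, IsHurwitz (agentLoop κ μ i) := by
  rw [eventually_all]
  intro i
  have hcont : Continuous fun μ : g.Uncertainty => agentLoop κ μ i := by
    have hi : Continuous fun μ : g.Uncertainty => μ i := continuous_apply i
    refine Continuous.matrix_fromBlocks ?_ ?_ ?_ continuous_const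
    · exact continuous_const.add hi.fst
    · exact (continuous_const.add hi.snd.fst).matrix_mul continuous_const
    · exact continuous_const.matrix_mul
        (continuous_const.matrix_mul (continuous_const.add hi.snd.snd.snd))
  refine hcont.continuousAt.eventually (isOpen_setOf_isHurwitz.mem_nhds ?_)
  have h0 : agentLoop κ 0 i = fromBlocks (g.A i) (g.B i * (κ i).K)
      (fromRows (κ i).L (κ i).G₂ * g.RC i) (κ i).M₁ := by
    simp [agentLoop, Aμ, Bμ, Cμ, hess, RC, LocalController.M₂]
  change IsHurwitz (agentLoop κ 0 i)
  rw [h0]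
  exact isHurwitz_agent_loop (hκ i).1 (hκ i).2

theorem wellFounded_upstream {G : Digraph (Fin N)} (hloop : NoLoop G) :
    WellFounded (Relation.TransGen G.Adj) :=
  have : Std.Irrefl (Relation.TransGen G.Adj) := ⟨hloop⟩
  Finite.wellFounded_of_trans_of_irrefl _

theorem isHurwitz_closedLoopMatrix {G : Digraph (Fin N)} (hG : g.UsesGraph G) (hloop : NoLoop G)
    {κ : ∀ i, g.LocalController i} {μ : g.Uncertainty}
    (h : ∀ i, IsHurwitz (agentLoop κ μ i)) : IsHurwitz (closedLoopMatrix κ μ) := by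
  intro z hz
  obtain ⟨v, hv, hvz⟩ := mem_spec_iff_exists_mulVec.1 hz
  obtain ⟨X, E, rfl⟩ : ∃ X E, v = Sum.elim X E := ⟨_, _, (Sum.elim_comp_inl_inr v).symm⟩
  set x : ∀ i, Fin (g.n i) → ℂ := fun i a => X ⟨i, a⟩ with hx
  set η : ∀ i, g.CtrlIdx i → ℂ := fun i a => E ⟨i, a⟩ with hη
  have hne : {i | Sum.elim (x i) (η i) ≠ 0}.Nonempty := by
    by_contra hemp
    rw [Set.not_nonempty_iff_eq_empty, Set.eq_empty_iff_forall_notMem] at hemp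
    refine hv (funext ?_)
    rintro (⟨i, a⟩ | ⟨i, a⟩)
    · exact congrFun (not_not.1 (hemp i)) (Sum.inl a)
    · exact congrFun (not_not.1 (hemp i)) (Sum.inr a)
  -- At a most upstream agent where the eigenvector is nonzero, the neighbors contribute nothing, so
  -- its component is an eigenvector of its own loop.
  obtain ⟨i, hi, hmin⟩ := (wellFounded_upstream hloop).has_min _ hne
  have hup : ∀ j, G.Adj j i → x j = 0 := by
    intro j hj
    have := not_not.1 fun hj' => hmin j hj' (Relation.TransGen.single hj)
    exact funext fun a => congrFun this (Sum.inl a)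
  refine h i z (mem_spec_iff_exists_mulVec.2 ⟨_, hi, ?_⟩)
  rw [closedLoopMatrix] at hvz
  simp only [Matrix.fromBlocks_map, Matrix.fromBlocks_mulVec, Sum.elim_comp_inl, Sum.elim_comp_inr,
    map_mul_ofReal, ← Matrix.mulVec_mulVec] at hvz
  simp only [agentLoop, Matrix.fromBlocks_map, Matrix.fromBlocks_mulVec, Sum.elim_comp_inl,
    Sum.elim_comp_inr, map_mul_ofReal, ← Matrix.mulVec_mulVec]
  ext (a | a)
  · have := congrFun hvz (Sum.inl ⟨i, a⟩)
    simp only [Sum.elim_inl, Pi.add_apply, Pi.smul_apply, blockDiagonal'_map_mulVec_apply] at this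
    exact this
  · have := congrFun hvz (Sum.inr ⟨i, a⟩)
    simp only [Sum.elim_inr, Pi.add_apply, Pi.smul_apply, blockDiagonal'_map_mulVec_apply] at this
    have hRb : (fun b => (g.Rbar.map Complex.ofReal *ᵥ
        ((blockDiagonal' (Cμ μ)).map Complex.ofReal *ᵥ X)) ⟨i, b⟩) =
        (g.hess i).map Complex.ofReal *ᵥ ((Cμ μ i).map Complex.ofReal *ᵥ x i) := by
      ext b
      rw [mulVec_sigma_apply, Finset.sum_eq_single i]
      · simp only [blockDiagonal'_map_mulVec_apply]
        rw [← Rbar_block_self]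
        rfl
      · intro j _ hj
        simp only [blockDiagonal'_map_mulVec_apply]
        by_cases hadj : G.Adj j i
        · have h0 := hup j hadj
          rw [hx] at h0
          simp only at h0
          rw [h0]
          simp [Matrix.mulVec, dotProduct]
        · have h0 : (Matrix.of fun a b => g.Rbar.map Complex.ofReal ⟨i, a⟩ ⟨j, b⟩) = 0 := by
            have : (Matrix.of fun a b => g.Rbar.map Complex.ofReal ⟨i, a⟩ ⟨j, b⟩) =
                (Matrix.of fun a b => g.Rbar ⟨i, a⟩ ⟨j, b⟩).map Complex.ofReal := rfl
            rw [this, Rbar_block_of_ne hj, (hG i j hj hadj).1, map_zero_ofReal]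
          rw [h0, Matrix.zero_mulVec, Pi.zero_apply]
      · simp
    rw [hRb] at this
    exact this

theorem tendsto_output {G : Digraph (Fin N)} (hR : ∀ i, IsPosDef (g.R i i)) (hG : g.UsesGraph G)
    (hloop : NoLoop G) (hS : ∀ i, ∀ z ∈ spec (g.S i), 0 ≤ z.re)
    {κ : ∀ i, g.LocalController i} (hκ : ∀ i, g.IsInternalModel i (κ i).G₁ (κ i).G₂)
    {μ : g.Uncertainty} (h : ∀ i, IsHurwitz (agentLoop κ μ i)) {yStar : g.Outputs}
    (hy : g.Rbar *ᵥ g.stack yStar + g.Qbar = 0)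
    {w : ∀ i, ℝ → Fin (g.q i) → ℝ} {x : ∀ i, ℝ → Fin (g.n i) → ℝ}
    {η : ∀ i, ℝ → g.CtrlIdx i → ℝ} (htraj : IsTrajectory κ μ w x η) :
    Tendsto (output μ x) atTop (𝓝 yStar) := by
  rw [Rbar_mulVec_stack_add_Qbar_eq_zero_iff] at hy
  rw [tendsto_pi_nhds]
  intro i
  induction i using (wellFounded_upstream hloop).induction with
  | _ i ih =>
  -- The neighbors' influence is split into its value at the equilibrium, absorbed in the constant
  -- `v` below, and the deviation `d`, which vanishes by induction.
  set d : ℝ → Fin (g.p i) → ℝ := fun t =>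
    ∑ j ∈ Finset.univ.erase i, g.R i j *ᵥ (output μ x t j - yStar j) with hd
  have hd0 : Tendsto d atTop (𝓝 0) := by
    rw [← Finset.sum_const_zero (s := Finset.univ.erase i)]
    refine tendsto_finsetSum _ fun j hj => ?_
    by_cases hadj : G.Adj j i
    · refine Tendsto.matrix_mulVec_zero _ ?_
      simpa using (ih j (Relation.TransGen.single hadj)).sub_const (yStar j)
    · rw [(hG i j (Finset.ne_of_mem_erase hj) hadj).1]
      simp
  set v : Fin (g.p i) → ℝ := g.Q i + ∑ j ∈ Finset.univ.erase i, g.R i j *ᵥ yStar j with hv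
  have hgrad : ∀ t, g.partialGrad i (output μ x t) = (g.hess i * Cμ μ i) *ᵥ x i t + v + d t := by
    intro t
    rw [partialGrad_eq_grad, grad, hv, hd, ← Matrix.mulVec_mulVec]
    simp only [Matrix.mulVec_sub, Finset.sum_sub_distrib]
    change g.hess i *ᵥ (Cμ μ i *ᵥ x i t) + _ + _ = _
    abel
  have key := tendsto_agent_error (hS i) (hκ i) (h i) v (htraj.exosystem i)
    (P := Pμ μ i) (x := x i) (η := η i) (d := d)
    (fun t ht => by simpa only [Matrix.mulVec_mulVec] using htraj.agent i t ht)
    (fun t ht => by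
      have := htraj.controller i t ht
      rw [hgrad] at this
      exact this) hd0
  have hdet := (Matrix.isUnit_iff_isUnit_det _).1 (isUnit_hess hR i)
  have hstar : g.hess i *ᵥ yStar i = -v := by
    refine eq_neg_of_add_eq_zero_left ?_
    rw [← hy i, grad, hv, add_assoc]
  -- The vanishing quantity is the Hessian applied to the output's deviation from equilibrium, so
  -- inverting the Hessian gives convergence of the output.
  have hlim := key.matrix_mulVec_zero (g.hess i)⁻¹
  have heq : ∀ t, (g.hess i)⁻¹ *ᵥ ((g.hess i * Cμ μ i) *ᵥ x i t + v) =
      output μ x t i - yStar i := by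
    intro t
    rw [← neg_eq_iff_eq_neg.2 hstar, ← sub_eq_add_neg, Matrix.mulVec_sub, Matrix.mulVec_mulVec,
      Matrix.mulVec_mulVec, ← Matrix.mul_assoc, Matrix.nonsing_inv_mul _ hdet, Matrix.one_mul,
      Matrix.one_mulVec, output]
  simp only [heq] at hlim
  simpa using hlim.add_const (yStar i)

end NetworkGame

end NashSeeking

end

theorem theorem1 {N : ℕ} (g : NashSeeking.NetworkGame N) (G : Digraph (Fin N))
    -- the costs
    (hR : ∀ i, NashSeeking.IsPosDef (g.R i i))
    (hG : g.UsesGraph G)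
    -- the standing assumptions of the problem
    (hRbar : NashSeeking.IsPosDef g.Rbar)
    (hS : ∀ i, ∀ z ∈ NashSeeking.spec (g.S i), 0 ≤ z.re)
    -- stabilizability and detectability
    (hstab : ∀ i, NashSeeking.IsStabilizable (g.A i) (g.B i))
    (hdet : ∀ i, NashSeeking.IsDetectable (g.A i) (g.C i))
    -- rank condition
    (hrank : ∀ i, ∀ z ∈ NashSeeking.spec (g.S i) ∪ {0},
      (Matrix.fromBlocks ((g.A i).map Complex.ofReal - z • 1) ((g.B i).map Complex.ofReal)
        ((g.C i).map Complex.ofReal) 0).rank = g.n i + g.p i)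
    -- the digraph has no loop
    (hloop : NashSeeking.NoLoop G) :
    ∃ yStar : g.Outputs,
      -- the unique Nash equilibrium
      g.IsNash yStar ∧ (∀ y, g.IsNash y → y = yStar) ∧
      g.Rbar *ᵥ g.stack yStar + g.Qbar = 0 ∧
      -- every agent can choose its controller from its own data
      (∀ i, ∃ L, g.IsObserverGain i L) ∧
      (∀ i, ∃ G₁ G₂, g.IsInternalModel i G₁ G₂) ∧
      (∀ i G₁ G₂, g.IsInternalModel i G₁ G₂ → ∃ K, g.IsStabilizingGain i G₁ G₂ K) ∧
      -- and every such choice solves the problem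
      ∀ κ : ∀ i, g.LocalController i,
        (∀ i, g.IsObserverGain i (κ i).L ∧ g.IsInternalModel i (κ i).G₁ (κ i).G₂ ∧
          g.IsStabilizingGain i (κ i).G₁ (κ i).G₂ (κ i).K) →
        NashSeeking.NetworkGame.SolvesNashSeeking κ yStar := by
  obtain ⟨yStar, hy, huniq⟩ := NashSeeking.NetworkGame.existsUnique_equilibrium hRbar
  have hNash := NashSeeking.NetworkGame.isNash_iff hR
  refine ⟨yStar, (hNash yStar).2 hy, fun y hyN => huniq y ((hNash y).1 hyN), hy,
    fun i => NashSeeking.NetworkGame.exists_isObserverGain hR (hdet i),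
    NashSeeking.NetworkGame.exists_isInternalModel,
    fun i G₁ G₂ hG₁₂ => NashSeeking.NetworkGame.exists_isStabilizingGain hR (hS i) (hstab i)
      (hrank i) hG₁₂, fun κ hκ => ?_⟩
  filter_upwards [NashSeeking.NetworkGame.eventually_isHurwitz_agentLoop
    fun i => ⟨(hκ i).1, (hκ i).2.2⟩] with μ hμ
  exact ⟨NashSeeking.NetworkGame.isHurwitz_closedLoopMatrix hG hloop hμ, fun w x η htraj =>
    NashSeeking.NetworkGame.tendsto_output hR hG hloop hS (fun i => (hκ i).2.1) hμ hy htraj⟩
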